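/- Let $c_0>0$, $\lambda_0>0$, and let $w:[0,\infty)\to[0,\infty)$ be integrable on $[0,t]$ for every $t\ge 0$. Put $c(t)=c_0w(t)$, $\lambda(t)=\lambda_0w(t)$ and $\tau(t)=\int_0^t w(s)\,ds$. Let $N$ be a non-homogeneous Poisson process with rate $\lambda(t)$: $N(0)=0$, the paths are almost surely nondecreasing and right-continuous, increments are independent, and $N(t)-N(s)$ is Poisson with mean $\int_s^t\lambda(u)\,du$ for $s\le t$. Let $D$ be independent of $N$ with $P\{D=1\}=P\{D=-1\}=\tfrac12$. The non-homogeneous telegraph process with velocity $c$ and switching rate $\lambda$, started at $0$, is $$X(t)=\int_0^t V(s)\,ds,\qquad V(s)=c(s)\,D\,(-1)^{N(s)};$$ the classical telegraph process $Y$ with velocity $c_0$ and rate $\lambda_0$ is the same process with constant coefficients $c_0,\lambda_0$. Let $I_0(z)=\sum_{k\ge0}(z/2)^{2k}/(k!)^2$. Then each $X(t)$ is a random variable (measurable up to a null event), and: 1. (Time change.) For every $t\ge0$, $X(t)$ has the same law as $Y(\tau(t))$. 2. (Absolutely continuous and singular parts.) For almost every $t>0$, $\tau'(t)=w(t)$.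 At every $t>0$ at which $w(t)>0$ and $\tau$ is differentiable with $\tau'(t)=w(t)$, the law of $X(t)$ is the sum of the absolutely continuous measure on $\{|x|<c_0\tau(t)\}$ with the nonnegative density $$\frac{e^{-\lambda_0\tau(t)}}{2}\left[\frac{\lambda_0}{c_0}I_0\!\left(\frac{\lambda_0}{c_0}\sqrt{c_0^2\tau(t)^2-x^2}\right)+\frac{1}{c_0w(t)}\frac{\partial}{\partial t}I_0\!\left(\frac{\lambda_0}{c_0}\sqrt{c_0^2\tau(t)^2-x^2}\right)\right]$$ (the $t$-derivative exists for every such $x$), and of the singular measure $\frac{e^{-\lambda_0\tau(t)}}{2}\left(\delta_{\int_0^t c(s)ds}+\delta_{-\int_0^t c(s)ds}\right)$. 3. (Boundary atoms.) For every $t$ with $\tau(t)>0$, $$P\Big\{X(t)=\int_0^t c(s)\,ds\Big\}=P\Big\{X(t)=-\int_0^t c(s)\,ds\Big\}=\frac{e^{-\lambda_0\tau(t)}}{2}.$$ 4. (No changes of direction.) For every $t\ge 0$, up to a null event, $X(t)\in\{\pm\int_0^t c(s)\,ds\}$ if and only if $N(t)=0$. -/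

import Mathlib

open MeasureTheory ProbabilityTheory Set
open scoped NNReal ENNReal

universe u v

/-- `N` is a non-homogeneous Poisson (counting) process on `[0, ∞)` with rate function `rate`:
it starts at `0`, its paths are almost surely nondecreasing and right-continuous, its increments
are independent, and `N t - N s` is Poisson distributed with mean `∫ u in s..t, rate u`. -/
structure IsPoissonProcess {Ω : Type*} [MeasurableSpace Ω] (rate : ℝ → ℝ)
    (N : ℝ≥0 → Ω → ℕ) (P : Measure Ω) : Prop where
  measurable : ∀ t, Measurable (N t)
  zero : ∀ᵐ ω ∂P, N 0 ω = 0
  monotone : ∀ᵐ ω ∂P, Monotone (fun t => N t ω)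
  rightContinuous : ∀ᵐ ω ∂P, ∀ t : ℝ≥0, ContinuousWithinAt (fun s => N s ω) (Ici t) t
  increments : ∀ s t : ℝ≥0, s ≤ t →
    P.map (fun ω => N t ω - N s ω) = poissonMeasure (∫ u in (s : ℝ)..t, rate u).toNNReal
  indepIncrements : HasIndepIncrements N P

/-- The random ingredients of a (non-homogeneous) telegraph process with switching rate `rate`:
the switching times are the jump times of the Poisson process `N`, and the initial direction `D`
is `1` or `-1` with probability `1/2` each, independently of the whole process `N`. -/
structure IsTelegraphNoise {Ω : Type*} [MeasurableSpace Ω] (rate : ℝ → ℝ)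
    (D : Ω → ℝ) (N : ℝ≥0 → Ω → ℕ) (P : Measure Ω) : Prop where
  poisson : IsPoissonProcess rate N P
  measurable_dir : Measurable D
  dir_pos : P {ω | D ω = 1} = 1 / 2
  dir_neg : P {ω | D ω = -1} = 1 / 2
  indep : IndepFun D (fun ω (t : ℝ≥0) => N t ω) P

/-- The velocity at time `t`: it is `c t` or `-c t`, with the sign reversed at each switch. -/
def telegraphVelocity {Ω : Type*} (c : ℝ → ℝ) (D : Ω → ℝ) (N : ℝ≥0 → Ω → ℕ)
    (t : ℝ≥0) (ω : Ω) : ℝ :=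
  c t * (D ω * (-1) ^ N t ω)

/-- The position at time `t` of the particle that starts at the origin. -/
noncomputable def telegraphPosition {Ω : Type*} (c : ℝ → ℝ) (D : Ω → ℝ) (N : ℝ≥0 → Ω → ℕ)
    (t : ℝ≥0) (ω : Ω) : ℝ :=
  ∫ s in (0 : ℝ)..t, telegraphVelocity c D N s.toNNReal ω

/-- The modified Bessel function `I₀`. -/
noncomputable def besselI0 (z : ℝ) : ℝ :=
  ∑' k : ℕ, (z / 2) ^ (2 * k) * (1 / (k.factorial : ℝ) ^ 2)

/-- The new time `τ = ∫₀ᵗ w(s) ds`. -/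
noncomputable def timeChange (w : ℝ → ℝ) (t : ℝ) : ℝ :=
  ∫ s in (0 : ℝ)..t, w s

/-- `I₀ ((lam0 / c0) * √((c0 τ)² - x²))` with `τ = ∫₀ᵗ w(s) ds`, as a function of `x` and `t`. -/
noncomputable def besselTerm (c0 lam0 : ℝ) (w : ℝ → ℝ) (x t : ℝ) : ℝ :=
  besselI0 (lam0 / c0 * √((c0 * timeChange w t) ^ 2 - x ^ 2))

/-- The density formula of the absolutely continuous part at time `t` and `|x| < c0 τ`. -/
noncomputable def telegraphDensity (c0 lam0 : ℝ) (w : ℝ → ℝ) (t x : ℝ) : ℝ :=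
  Real.exp (-lam0 * timeChange w t) / 2 *
    (lam0 / c0 * besselTerm c0 lam0 w x t +
      1 / (c0 * w t) * deriv (fun u => besselTerm c0 lam0 w x u) t)

/-! The law is identified through its characteristic function, with no conditioning on switching
times. Write Z for the position of the particle that first moves right, Q(t) = (-1)^N(t), u(t) = E
cos(ξ Z(t)) and v(t) = E[Q(t) sin(ξ Z(t))]. Along each path, cos(ξ Z) and sin(ξ Z) are integrals of
their derivatives, which carry the factor c₀ w Q. Since Q(t) Q(r) is the parity of an increment
independent of the past of r, and a Poisson variable of mean m has mean parity exp(-2m), taking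
expectations gives a closed linear Volterra system for u and v
(`IsRegularPoissonProcess.integral_cos_pathPosition`).

Grönwall's inequality makes its solution unique, and a solution is explicit in the time τ: u =
exp(-λ₀τ) (C(τ) + λ₀ S(τ)), where C and S are the fundamental solutions of y'' = (λ₀² - ξ²c₀²) y
(`eq_of_volterra_system`). Only τ enters, whence the time change. The random direction, of mean zero
and independent of Z, removes the sine part, so u is the characteristic function of X.

On the other side, the candidate law (`classicalLaw`) has the same transform: expanding cosine and
Bessel series reduces it to Beta integrals, whose sums over n + m = N collapse by the binomial
theorem (`charFun_classicalLaw`). Characteristic functions determine finite measures, so the laws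
agree. The atoms are then read off, and their total mass equals the probability of no switch, which
forces the two events to coincide almost surely. -/

/-! ### Chain rule along primitives and Grönwall's inequality. -/

theorem LipschitzOnWith.comp_absolutelyContinuousOnInterval {F f : ℝ → ℝ} {a b : ℝ} {K : ℝ≥0}
    {s : Set ℝ} (hF : LipschitzOnWith K F s) (hf : AbsolutelyContinuousOnInterval f a b)
    (hs : MapsTo f (uIcc a b) s) : AbsolutelyContinuousOnInterval (fun x => F (f x)) a b := by
  have hK := Filter.Tendsto.const_mul (K : ℝ) hf
  rw [mul_zero] at hK
  refine squeeze_zero' (Filter.Eventually.of_forall fun E => Finset.sum_nonneg fun _ _ => dist_nonneg)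
    ?_ hK
  filter_upwards [Filter.mem_inf_of_right (Filter.mem_principal_self _)] with E hE
  rw [Finset.mul_sum]
  exact Finset.sum_le_sum fun i hi => hF.dist_le_mul _ (hs (hE.1 i hi).1) _ (hs (hE.1 i hi).2)

/-- Chain rule for the composition of a `C¹` function with a primitive of an integrable function. -/
theorem integral_mul_deriv_comp_primitive {f F F' : ℝ → ℝ} {a b : ℝ}
    (hf : IntervalIntegrable f volume a b) (hF : ∀ x, HasDerivAt F (F' x) x) (hF' : Continuous F') :
    ∫ r in a..b, f r * F' (∫ s in a..r, f s) = F (∫ s in a..b, f s) - F 0 := by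
  have hac := hf.absolutelyContinuousOnInterval_intervalIntegral (c := a) (by simp)
  -- The primitive stays in a compact interval, on which `F` is Lipschitz. The composition is thus
  -- absolutely continuous, and the fundamental theorem applies although the derivative is known
  -- only almost everywhere.
  obtain ⟨R, hR⟩ := (isCompact_uIcc.image_of_continuousOn hac.continuousOn).isBounded.subset_closedBall 0
  rw [Real.closedBall_eq_Icc] at hR
  have hC1 : ContDiff ℝ 1 F := by
    rw [contDiff_one_iff_deriv]
    refine ⟨fun x => (hF x).differentiableAt, ?_⟩
    rwa [funext fun x => (hF x).deriv]
  obtain ⟨K, hK⟩ := hC1.contDiffOn.exists_lipschitzOnWith (by decide) (convex_Icc (0 - R) (0 + R))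
    isCompact_Icc
  have hcomp := hK.comp_absolutelyContinuousOnInterval hac (mapsTo_iff_image_subset.2 hR)
  have := hcomp.integral_deriv_eq_sub
  rw [intervalIntegral.integral_same] at this
  rw [← this]
  refine intervalIntegral.integral_congr_ae ?_
  filter_upwards [hf.ae_hasDerivAt_integral] with x hx hxab
  have h1 := (hF _).comp x (hx (uIoc_subset_uIcc hxab) a (by simp))
  rw [mul_comm]
  exact h1.deriv.symm

theorem hasDerivAt_pow_succ_div_factorial (n : ℕ) (x : ℝ) :
    HasDerivAt (fun y : ℝ => y ^ (n + 1) / (n + 1).factorial) (x ^ n / n.factorial) x := by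
  have := (hasDerivAt_pow (n + 1) x).div_const ((n + 1).factorial : ℝ)
  refine this.congr_deriv ?_
  rw [Nat.factorial_succ]
  push_cast
  have : (n.factorial : ℝ) ≠ 0 := by positivity
  field_simp

theorem timeChange_nonneg {w : ℝ → ℝ} (hw : ∀ s, 0 ≤ w s) {t : ℝ} (ht : 0 ≤ t) :
    0 ≤ timeChange w t :=
  intervalIntegral.integral_nonneg ht fun _ _ => hw _

theorem continuous_timeChange {w : ℝ → ℝ} (hwi : ∀ a b, IntervalIntegrable w volume a b) :
    Continuous (timeChange w) :=
  intervalIntegral.continuous_primitive hwi 0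

/-- Grönwall's inequality with zero initial value, relative to an integrable weight. -/
theorem eq_zero_of_le_mul_integral {w g : ℝ → ℝ} {K B t₀ : ℝ} (hw : ∀ s, 0 ≤ w s)
    (hwi : ∀ a b, IntervalIntegrable w volume a b) (hK : 0 ≤ K) (hg0 : ∀ t, 0 ≤ g t)
    (hgm : Measurable g) (hgB : ∀ t, 0 ≤ t → t ≤ t₀ → g t ≤ B)
    (hg : ∀ t, 0 ≤ t → t ≤ t₀ → g t ≤ K * ∫ r in (0 : ℝ)..t, w r * g r) {t : ℝ} (ht : 0 ≤ t)
    (htt : t ≤ t₀) : g t = 0 := by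
  have hB : 0 ≤ B := (hg0 t).trans (hgB t ht htt)
  -- Iterating the inequality n times produces the n-th term of an exponential series in K τ, which
  -- tends to zero.
  have key : ∀ n : ℕ, ∀ s, 0 ≤ s → s ≤ t₀ →
      g s ≤ B * K ^ n * (timeChange w s ^ n / n.factorial) := by
    intro n
    induction n with
    | zero => intro s hs hst; simpa using hgB s hs hst
    | succ n ih =>
      intro s hs hst
      have hchain := integral_mul_deriv_comp_primitive (hwi 0 s)
        (hasDerivAt_pow_succ_div_factorial n) (by fun_prop)
      have hint : IntervalIntegrable
          (fun r => w r * (timeChange w r ^ n / n.factorial)) volume 0 s :=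
        (hwi 0 s).mul_continuousOn
          (((continuous_timeChange hwi).pow n).div_const _).continuousOn
      have hle : ∫ r in (0 : ℝ)..s, w r * g r ≤
          ∫ r in (0 : ℝ)..s, B * K ^ n * (w r * (timeChange w r ^ n / n.factorial)) := by
        refine intervalIntegral.integral_mono_on hs ?_ (hint.const_mul _) ?_
        · refine IntervalIntegrable.mono_fun (hint.const_mul (B * K ^ n)) ?_ ?_
          · exact (intervalIntegrable_iff.1 (hwi 0 s)).aestronglyMeasurable.mul hgm.aestronglyMeasurable
          · refine (ae_restrict_iff' measurableSet_uIoc).2 (.of_forall fun r hr => ?_)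
            rw [uIoc_of_le hs] at hr
            beta_reduce
            rw [Real.norm_of_nonneg (mul_nonneg (hw r) (hg0 r)), Real.norm_of_nonneg]
            · calc w r * g r ≤ w r * (B * K ^ n * (timeChange w r ^ n / n.factorial)) :=
                    mul_le_mul_of_nonneg_left (ih r hr.1.le (hr.2.trans hst)) (hw r)
                _ = _ := by ring
            · have := timeChange_nonneg hw hr.1.le
              have := hw r
              positivity
        · intro r hr
          calc w r * g r ≤ w r * (B * K ^ n * (timeChange w r ^ n / n.factorial)) :=
                mul_le_mul_of_nonneg_left (ih r hr.1 (hr.2.trans hst)) (hw r)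
            _ = _ := by ring
      rw [intervalIntegral.integral_const_mul] at hle
      have hch : ∫ r in (0 : ℝ)..s, w r * (timeChange w r ^ n / n.factorial) =
          timeChange w s ^ (n + 1) / (n + 1).factorial := by
        simpa [timeChange] using hchain
      rw [hch] at hle
      calc g s ≤ K * ∫ r in (0 : ℝ)..s, w r * g r := hg s hs hst
        _ ≤ K * (B * K ^ n * (timeChange w s ^ (n + 1) / (n + 1).factorial)) := by gcongr
        _ = _ := by ring
  refine le_antisymm ?_ (hg0 t)
  have hlim : Filter.Tendsto (fun n : ℕ => B * ((K * timeChange w t) ^ n / n.factorial))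
      Filter.atTop (nhds (B * 0)) :=
    (FloorSemiring.tendsto_pow_div_factorial_atTop (K * timeChange w t)).const_mul B
  rw [mul_zero] at hlim
  refine ge_of_tendsto' hlim fun n => (key n t ht htt).trans_eq ?_
  rw [mul_pow]; ring

/-! ### The linear differential equation and the Volterra system. -/

/-- The two fundamental solutions of `y'' = M y`, with their power series. -/
theorem exists_fundamental_solutions (M : ℝ) : ∃ C S : ℝ → ℝ,
    (∀ x, HasDerivAt C (M * S x) x) ∧ (∀ x, HasDerivAt S (C x) x) ∧ C 0 = 1 ∧ S 0 = 0 ∧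
    (∀ x, HasSum (fun n : ℕ => M ^ n * (x ^ (2 * n) / (2 * n).factorial)) (C x)) ∧
    ∀ x, HasSum (fun n : ℕ => M ^ n * (x ^ (2 * n + 1) / (2 * n + 1).factorial)) (S x) := by
  rcases lt_trichotomy M 0 with hM | rfl | hM
  · obtain ⟨a, ha, rfl⟩ : ∃ a : ℝ, 0 < a ∧ M = -a ^ 2 :=
      ⟨√(-M), Real.sqrt_pos.2 (by linarith), by rw [Real.sq_sqrt (by linarith)]; ring⟩
    refine ⟨fun x => Real.cos (a * x), fun x => Real.sin (a * x) / a, fun x => ?_, fun x => ?_,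
      by simp, by simp, fun x => ?_, fun x => ?_⟩
    · refine ((hasDerivAt_id' x).const_mul a).cos.congr_deriv ?_
      field_simp
    · refine (((hasDerivAt_id' x).const_mul a).sin.div_const a).congr_deriv ?_
      field_simp
    · convert! Real.hasSum_cos (a * x) using 2 with n
      rw [neg_pow, mul_pow, pow_mul a]; ring
    · convert! (Real.hasSum_sin (a * x)).div_const a using 2 with n
      rw [neg_pow, mul_pow, pow_succ a (2 * n), pow_mul a]; field_simp
  · refine ⟨fun _ => 1, fun x => x, fun x => ?_, fun x => hasDerivAt_id x, rfl, rfl, fun x => ?_,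
      fun x => ?_⟩
    · simpa using hasDerivAt_const x (1 : ℝ)
    · convert hasSum_single (0 : ℕ) (fun n hn => ?_) using 1
      · simp
      · simp [hn]
    · convert hasSum_single (0 : ℕ) (fun n hn => ?_) using 1
      · simp
      · simp [hn]
  · obtain ⟨a, ha, rfl⟩ : ∃ a : ℝ, 0 < a ∧ M = a ^ 2 :=
      ⟨√M, Real.sqrt_pos.2 hM, by rw [Real.sq_sqrt hM.le]⟩
    refine ⟨fun x => Real.cosh (a * x), fun x => Real.sinh (a * x) / a, fun x => ?_, fun x => ?_,
      by simp, by simp, fun x => ?_, fun x => ?_⟩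
    · refine ((hasDerivAt_id' x).const_mul a).cosh.congr_deriv ?_
      field_simp
    · refine (((hasDerivAt_id' x).const_mul a).sinh.div_const a).congr_deriv ?_
      field_simp
    · convert! Real.hasSum_cosh (a * x) using 2 with n
      rw [mul_pow, pow_mul a]; ring
    · convert! (Real.hasSum_sinh (a * x)).div_const a using 2 with n
      rw [mul_pow, pow_succ a (2 * n), pow_mul a]; field_simp

theorem IntervalIntegrable.mul_of_abs_le_one {w f : ℝ → ℝ} {a b : ℝ}
    (hw : IntervalIntegrable w volume a b) (hf : Measurable f) (hfB : ∀ t, |f t| ≤ 1) :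
    IntervalIntegrable (fun r => w r * f r) volume a b :=
  intervalIntegrable_iff.2 ((intervalIntegrable_iff.1 hw).mul_bdd hf.aestronglyMeasurable
    (.of_forall hfB))

theorem timeChange_mono {w : ℝ → ℝ} (hw : ∀ s, 0 ≤ w s)
    (hwi : ∀ a b, IntervalIntegrable w volume a b) : Monotone (timeChange w) := by
  intro a b hab
  have := intervalIntegral.integral_add_adjacent_intervals (hwi 0 a) (hwi a b)
  have h0 := intervalIntegral.integral_nonneg (μ := volume) hab fun s _ => hw s
  simp only [timeChange]
  linarith

/-- The Volterra system satisfied by the characteristic function of a telegraph process and its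
solution. -/
theorem eq_of_volterra_system {w u v C S : ℝ → ℝ} {η lam t₀ : ℝ} (hw : ∀ s, 0 ≤ w s)
    (hwi : ∀ a b, IntervalIntegrable w volume a b) (hlam : 0 ≤ lam) (ht₀ : 0 ≤ t₀)
    (hum : Measurable u) (hvm : Measurable v) (huB : ∀ t, |u t| ≤ 1) (hvB : ∀ t, |v t| ≤ 1)
    (hu : ∀ t, 0 ≤ t → u t = 1 - η * ∫ r in (0 : ℝ)..t, w r * v r)
    (hv : ∀ t, 0 ≤ t → v t = η * ∫ r in (0 : ℝ)..t,
      w r * (Real.exp (-2 * lam * (timeChange w t - timeChange w r)) * u r))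
    (hC : ∀ x, HasDerivAt C ((lam ^ 2 - η ^ 2) * S x) x) (hS : ∀ x, HasDerivAt S (C x) x)
    (hC0 : C 0 = 1) (hS0 : S 0 = 0) :
    u t₀ = Real.exp (-lam * timeChange w t₀) *
      (C (timeChange w t₀) + lam * S (timeChange w t₀)) := by
  set τ := timeChange w with hτ
  have hτc : Continuous τ := continuous_timeChange hwi
  -- In the time τ the system reads U' = -η V, V' = η U - 2 lam V with U(0) = 1, V(0) = 0. The
  -- integrating factor exp(2 lam x) puts the second equation in the form of the Volterra kernel.
  set U : ℝ → ℝ := fun x => Real.exp (-lam * x) * (C x + lam * S x) with hU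
  set V : ℝ → ℝ := fun x => η * (Real.exp (-lam * x) * S x) with hV
  have hexp : ∀ x, HasDerivAt (fun x => Real.exp (-lam * x)) (-lam * Real.exp (-lam * x)) x :=
    fun x => (((hasDerivAt_id' x).const_mul (-lam)).exp).congr_deriv (by ring)
  have hU' : ∀ x, HasDerivAt U (-η * V x) x := fun x =>
    ((hexp x).mul ((hC x).add ((hS x).const_mul lam))).congr_deriv (by simp only [hV, Pi.add_apply]; ring)
  have hV' : ∀ x, HasDerivAt (fun x => V x * Real.exp (2 * lam * x))
      (η * (U x * Real.exp (2 * lam * x))) x := fun x =>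
    ((((hexp x).mul (hS x)).const_mul η).mul
      ((hasDerivAt_id' x).const_mul (2 * lam)).exp).congr_deriv
        (by simp only [hU, Pi.mul_apply]; ring)
  have hCc : Continuous C := continuous_iff_continuousAt.2 fun x => (hC x).continuousAt
  have hSc : Continuous S := continuous_iff_continuousAt.2 fun x => (hS x).continuousAt
  have hUc : Continuous U := by fun_prop
  have hVc : Continuous V := by fun_prop
  have hUint : ∀ t, U (τ t) = 1 - η * ∫ r in (0 : ℝ)..t, w r * V (τ r) := by
    intro t
    have h := integral_mul_deriv_comp_primitive (hwi 0 t) hU' (by fun_prop)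
    have h2 : ∫ r in (0 : ℝ)..t, w r * (-η * V (∫ s in (0 : ℝ)..r, w s)) =
        -η * ∫ r in (0 : ℝ)..t, w r * V (τ r) := by
      rw [← intervalIntegral.integral_const_mul]
      exact intervalIntegral.integral_congr fun r _ => by simp only [hτ, timeChange]; ring
    rw [h2] at h
    have hU0 : U 0 = 1 := by simp [hU, hC0, hS0]
    rw [hU0] at h
    simp only [hτ, timeChange] at h ⊢
    linarith
  have hVint : ∀ t, V (τ t) = η * ∫ r in (0 : ℝ)..t,
      w r * (Real.exp (-2 * lam * (τ t - τ r)) * U (τ r)) := by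
    intro t
    have h := integral_mul_deriv_comp_primitive (hwi 0 t) hV' (by fun_prop)
    have hV0 : V 0 = 0 := by simp [hV, hS0]
    simp only [hV0, zero_mul, sub_zero] at h
    change _ = V (τ t) * Real.exp (2 * lam * τ t) at h
    have h3 : V (τ t) = Real.exp (-2 * lam * τ t) * (V (τ t) * Real.exp (2 * lam * τ t)) := by
      rw [mul_comm (V _), ← mul_assoc, ← Real.exp_add]; ring_nf; simp
    rw [h3, ← h, ← intervalIntegral.integral_const_mul, ← intervalIntegral.integral_const_mul]
    refine intervalIntegral.integral_congr fun r _ => ?_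
    change _ * (w r * (η * (U (τ r) * Real.exp (2 * lam * τ r)))) = _
    rw [show -2 * lam * (τ t - τ r) = -2 * lam * τ t + 2 * lam * τ r by ring, Real.exp_add]
    ring
  obtain ⟨BU, hBU⟩ := (isCompact_Icc (a := (0 : ℝ)) (b := t₀)).exists_bound_of_continuousOn
    (hUc.comp hτc).continuousOn
  obtain ⟨BV, hBV⟩ := (isCompact_Icc (a := (0 : ℝ)) (b := t₀)).exists_bound_of_continuousOn
    (hVc.comp hτc).continuousOn
  have hbdd : ∀ {f : ℝ → ℝ}, Measurable f → (∀ t, |f t| ≤ 1) → ∀ t,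
      IntervalIntegrable (fun r => w r * f r) volume 0 t := fun hf hfB t =>
    (hwi 0 t).mul_of_abs_le_one hf hfB
  -- Each error is bounded by the integral of the other, so their sum satisfies a single Grönwall
  -- inequality.
  set g : ℝ → ℝ := fun t => |u t - U (τ t)| + |v t - V (τ t)| with hg
  have hgm : Measurable g := by
    have h1 := (hum.sub (hUc.comp hτc).measurable).norm
    have h2 := (hvm.sub (hVc.comp hτc).measurable).norm
    exact h1.add h2
  have hd : ∀ t, IntervalIntegrable (fun r => w r * |u r - U (τ r)|) volume 0 t := fun t => by
    have h := ((hbdd hum huB t).sub ((hwi 0 t).mul_continuousOn (hUc.comp hτc).continuousOn)).norm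
    refine h.congr fun r _ => ?_
    simp only [Function.comp, ← mul_sub, norm_mul, Real.norm_eq_abs, abs_of_nonneg (hw r)]
  have he : ∀ t, IntervalIntegrable (fun r => w r * |v r - V (τ r)|) volume 0 t := fun t => by
    have h := ((hbdd hvm hvB t).sub ((hwi 0 t).mul_continuousOn (hVc.comp hτc).continuousOn)).norm
    refine h.congr fun r _ => ?_
    simp only [Function.comp, ← mul_sub, norm_mul, Real.norm_eq_abs, abs_of_nonneg (hw r)]
  have hzero : g t₀ = 0 := by
    refine eq_zero_of_le_mul_integral (K := |η|) (B := (1 + BU) + (1 + BV)) hw hwi (abs_nonneg η)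
      (fun t => by positivity) hgm ?_ ?_ ht₀ le_rfl
    · intro t ht htt
      refine add_le_add ((abs_sub _ _).trans (add_le_add (huB t) (hBU t ⟨ht, htt⟩)))
        ((abs_sub _ _).trans (add_le_add (hvB t) (hBV t ⟨ht, htt⟩)))
    · intro t ht _
      have h1 : |u t - U (τ t)| ≤ |η| * ∫ r in (0 : ℝ)..t, w r * |v r - V (τ r)| := by
        have : u t - U (τ t) = η * ∫ r in (0 : ℝ)..t, w r * (V (τ r) - v r) := by
          simp only [mul_sub]
          rw [hu t ht, hUint t, intervalIntegral.integral_sub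
            ((hwi 0 t).mul_continuousOn (g := fun r => V (τ r)) (hVc.comp hτc).continuousOn)
            (hbdd hvm hvB t)]
          ring
        rw [this, abs_mul]
        refine mul_le_mul_of_nonneg_left
          ((intervalIntegral.abs_integral_le_integral_abs ht).trans_eq ?_) (abs_nonneg η)
        refine intervalIntegral.integral_congr fun r _ => ?_
        simp only [abs_mul, abs_of_nonneg (hw r), abs_sub_comm (V (τ r))]
      have h2 : |v t - V (τ t)| ≤ |η| * ∫ r in (0 : ℝ)..t, w r * |u r - U (τ r)| := by
        have hE : Continuous fun r => Real.exp (-2 * lam * (τ t - τ r)) := by fun_prop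
        have hi1 : IntervalIntegrable
            (fun r => w r * (Real.exp (-2 * lam * (τ t - τ r)) * u r)) volume 0 t := by
          refine ((hbdd hum huB t).mul_continuousOn hE.continuousOn).congr fun r _ => ?_
          ring
        have hi2 : IntervalIntegrable
            (fun r => w r * (Real.exp (-2 * lam * (τ t - τ r)) * U (τ r))) volume 0 t :=
          (hwi 0 t).mul_continuousOn (by fun_prop)
        have : v t - V (τ t) = η * ∫ r in (0 : ℝ)..t,
            Real.exp (-2 * lam * (τ t - τ r)) * (w r * (u r - U (τ r))) := by
          rw [hv t ht, hVint t, ← mul_sub, ← intervalIntegral.integral_sub hi1 hi2]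
          congr 1
          exact intervalIntegral.integral_congr fun r _ => by ring
        rw [this, abs_mul]
        refine mul_le_mul_of_nonneg_left
          ((intervalIntegral.abs_integral_le_integral_abs ht).trans ?_) (abs_nonneg η)
        refine intervalIntegral.integral_mono_on ht ?_ (hd t) fun r hr => ?_
        · exact ((hi1.sub hi2).congr fun r _ => by ring).abs
        · rw [abs_mul, abs_mul, abs_of_nonneg (hw r), Real.abs_exp]
          refine mul_le_of_le_one_left (mul_nonneg (hw r) (abs_nonneg _)) ?_
          rw [Real.exp_le_one_iff]
          have := timeChange_mono hw hwi hr.2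
          nlinarith [mul_nonneg hlam (sub_nonneg.2 this)]
      calc g t ≤ _ := add_le_add h1 h2
        _ = |η| * ∫ r in (0 : ℝ)..t, w r * g r := by
          rw [← mul_add, ← intervalIntegral.integral_add (he t) (hd t)]
          congr 1
          exact intervalIntegral.integral_congr fun r _ => by simp only [hg]; ring
  have hu0 : |u t₀ - U (τ t₀)| = 0 := by
    have h1 := abs_nonneg (u t₀ - U (τ t₀))
    have h2 := abs_nonneg (v t₀ - V (τ t₀))
    simp only [hg] at hzero
    linarith
  exact sub_eq_zero.1 (abs_eq_zero.1 hu0)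

/-! ### Bessel series and their cosine transforms. -/

/-- The series `∑ yⁿ / (n!)²`, for which `I₀ z` is the value at `z² / 4`. -/
noncomputable def besselSeries (y : ℝ) : ℝ := ∑' n : ℕ, 1 / (n.factorial : ℝ) ^ 2 * y ^ n

/-- The derivative `∑ yⁿ / (n! (n+1)!)` of `besselSeries`. -/
noncomputable def besselSeriesDeriv (y : ℝ) : ℝ :=
  ∑' n : ℕ, 1 / ((n.factorial : ℝ) * (n + 1).factorial) * y ^ n

theorem one_le_factorial_cast (n : ℕ) : (1 : ℝ) ≤ n.factorial := by
  exact_mod_cast Nat.factorial_pos n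

theorem abs_besselSeries_coeff_le (n : ℕ) :
    |1 / (n.factorial : ℝ) ^ 2| ≤ (1 / n.factorial : ℝ) := by
  rw [abs_of_nonneg (by positivity)]
  have := one_le_factorial_cast n
  exact one_div_le_one_div_of_le (by positivity) (by nlinarith)

theorem abs_besselSeriesDeriv_coeff_le (n : ℕ) :
    |1 / ((n.factorial : ℝ) * (n + 1).factorial)| ≤ (1 / n.factorial : ℝ) := by
  rw [abs_of_nonneg (by positivity)]
  have := one_le_factorial_cast n
  have := one_le_factorial_cast (n + 1)
  exact one_div_le_one_div_of_le (by positivity) (by nlinarith)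

theorem summable_mul_pow_of_le_inv_factorial {d : ℕ → ℝ} (hd : ∀ n, |d n| ≤ 1 / n.factorial)
    (y : ℝ) : Summable fun n => d n * y ^ n := by
  refine Summable.of_norm_bounded (Real.summable_pow_div_factorial |y|) fun n => ?_
  rw [norm_mul, norm_pow, Real.norm_eq_abs, Real.norm_eq_abs]
  calc |d n| * |y| ^ n ≤ 1 / n.factorial * |y| ^ n := by gcongr; exact hd n
    _ = _ := by ring

theorem continuous_tsum_mul_pow {d : ℕ → ℝ} (hd : ∀ n, |d n| ≤ 1 / n.factorial) :
    Continuous fun y : ℝ => ∑' n, d n * y ^ n := by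
  rw [continuous_iff_continuousAt]
  intro y
  refine ContinuousOn.continuousAt (s := Metric.ball 0 (|y| + 1)) ?_
    (Metric.isOpen_ball.mem_nhds (by simp))
  refine continuousOn_tsum (fun n => by fun_prop) (Real.summable_pow_div_factorial (|y| + 1))
    fun n x hx => ?_
  rw [mem_ball_zero_iff, Real.norm_eq_abs] at hx
  rw [norm_mul, norm_pow, Real.norm_eq_abs, Real.norm_eq_abs]
  calc |d n| * |x| ^ n ≤ 1 / n.factorial * (|y| + 1) ^ n := by gcongr; exact hd n
    _ = _ := by ring

theorem continuous_besselSeries : Continuous besselSeries :=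
  continuous_tsum_mul_pow abs_besselSeries_coeff_le

theorem continuous_besselSeriesDeriv : Continuous besselSeriesDeriv :=
  continuous_tsum_mul_pow abs_besselSeriesDeriv_coeff_le

theorem besselSeries_nonneg {y : ℝ} (hy : 0 ≤ y) : 0 ≤ besselSeries y :=
  tsum_nonneg fun _ => by positivity

theorem besselSeriesDeriv_nonneg {y : ℝ} (hy : 0 ≤ y) : 0 ≤ besselSeriesDeriv y :=
  tsum_nonneg fun _ => by positivity

theorem besselI0_eq (z : ℝ) : besselI0 z = besselSeries (z ^ 2 / 4) := by
  refine tsum_congr fun k => ?_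
  rw [pow_mul, mul_comm]
  congr 2
  ring

theorem besselSeries_succ_coeff (n : ℕ) (y : ℝ) :
    1 / ((n + 1).factorial : ℝ) ^ 2 * (((n + 1 : ℕ) : ℝ) * y ^ (n + 1 - 1)) =
      1 / ((n.factorial : ℝ) * (n + 1).factorial) * y ^ n := by
  rw [Nat.factorial_succ]
  push_cast
  have : (n.factorial : ℝ) ≠ 0 := by positivity
  field_simp

theorem hasDerivAt_besselSeries (y : ℝ) : HasDerivAt besselSeries (besselSeriesDeriv y) y := by
  have h := hasDerivAt_tsum_of_isPreconnected
    (g := fun (n : ℕ) (x : ℝ) => 1 / (n.factorial : ℝ) ^ 2 * x ^ n)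
    (g' := fun (n : ℕ) (x : ℝ) => 1 / (n.factorial : ℝ) ^ 2 * (n * x ^ (n - 1)))
    (u := fun n : ℕ => 1 / (n.factorial : ℝ) ^ 2 * (n * (|y| + 1) ^ (n - 1)))
    (t := Metric.ball 0 (|y| + 1)) (y₀ := y) (y := y) ?_ Metric.isOpen_ball
    (convex_ball _ _).isPreconnected (fun n x _ => (hasDerivAt_pow n x).const_mul _) ?_ (by simp)
    (summable_mul_pow_of_le_inv_factorial abs_besselSeries_coeff_le y) (by simp)
  · refine h.congr_deriv ?_
    -- The differentiated constant term vanishes; shifting the index gives the coefficients of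
    -- `besselSeriesDeriv`.
    rw [tsum_eq_zero_add']
    · simp only [besselSeries_succ_coeff]
      simp [besselSeriesDeriv]
    · simp only [besselSeries_succ_coeff]
      exact summable_mul_pow_of_le_inv_factorial abs_besselSeriesDeriv_coeff_le y
  · rw [← summable_nat_add_iff 1]
    simp only [besselSeries_succ_coeff]
    exact summable_mul_pow_of_le_inv_factorial abs_besselSeriesDeriv_coeff_le _
  · intro n x hx
    rw [mem_ball_zero_iff, Real.norm_eq_abs] at hx
    rw [norm_mul, norm_mul, norm_pow, Real.norm_eq_abs, Real.norm_eq_abs, Real.norm_eq_abs,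
      Nat.abs_cast, abs_of_nonneg (by positivity : (0 : ℝ) ≤ 1 / (n.factorial : ℝ) ^ 2)]
    gcongr

/-- Integration by parts, with boundary terms killed by the factor (a² - x²)^(n+1). It lowers the
exponent n + 1 at the price of raising m. -/
theorem integral_even_pow_mul_pow_sub_sq_succ (a : ℝ) (m n : ℕ) :
    (2 * m + 1) * ∫ x in -a..a, x ^ (2 * m) * (a ^ 2 - x ^ 2) ^ (n + 1) =
      2 * (n + 1) * ∫ x in -a..a, x ^ (2 * (m + 1)) * (a ^ 2 - x ^ 2) ^ n := by
  have hd : ∀ x : ℝ, HasDerivAt (fun x : ℝ => x ^ (2 * m + 1) * (a ^ 2 - x ^ 2) ^ (n + 1))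
      ((2 * m + 1) * (x ^ (2 * m) * (a ^ 2 - x ^ 2) ^ (n + 1)) -
        2 * (n + 1) * (x ^ (2 * (m + 1)) * (a ^ 2 - x ^ 2) ^ n)) x := by
    intro x
    refine ((hasDerivAt_pow (2 * m + 1) x).mul
      (((hasDerivAt_pow 2 x).const_sub (a ^ 2)).pow (n + 1))).congr_deriv ?_
    simp only [Nat.add_sub_cancel, Pi.pow_apply]
    push_cast
    ring
  have h := intervalIntegral.integral_eq_sub_of_hasDerivAt (a := -a) (b := a)
    (fun x _ => hd x) (Continuous.intervalIntegrable (by fun_prop) _ _)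
  rw [intervalIntegral.integral_sub (Continuous.intervalIntegrable (by fun_prop) _ _)
    (Continuous.intervalIntegrable (by fun_prop) _ _), intervalIntegral.integral_const_mul,
    intervalIntegral.integral_const_mul] at h
  simp only [neg_sq, sub_self, zero_pow (Nat.succ_ne_zero n), mul_zero] at h
  linarith

/-- A Beta integral, written with a binomial coefficient so that summation over n + m = N later
becomes the binomial theorem. -/
theorem integral_even_pow_mul_pow_sub_sq (a : ℝ) (m n : ℕ) :
    ∫ x in -a..a, x ^ (2 * m) * (a ^ 2 - x ^ 2) ^ n =
      2 * (2 * m).factorial * 4 ^ n * (n.factorial : ℝ) ^ 2 * (n + m).choose n /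
        (2 * (n + m) + 1).factorial * a ^ (2 * (n + m) + 1) := by
  induction n generalizing m with
  | zero =>
    have h1 : (2 * m + 1 : ℝ) ≠ 0 := by positivity
    have h2 : ((2 * m).factorial : ℝ) ≠ 0 := by positivity
    simp only [pow_zero, mul_one, integral_pow, zero_add, Nat.factorial_succ,
      (Odd.neg_pow ⟨m, rfl⟩ a : (-a) ^ (2 * m + 1) = _), Nat.choose_zero_right, Nat.factorial_zero]
    push_cast
    field_simp
    ring
  | succ n ih =>
    have h := integral_even_pow_mul_pow_sub_sq_succ a m n
    rw [ih] at h
    have h1 : (2 * m + 1 : ℝ) ≠ 0 := by positivity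
    rw [← mul_right_inj' h1, h]
    have hc : ((n + 1 + m).choose (n + 1) : ℝ) * (n + 1) = (n + 1 + m).choose n * (m + 1) := by
      have := Nat.choose_succ_right_eq (n + 1 + m) n
      rw [show n + 1 + m - n = m + 1 by omega] at this
      exact_mod_cast this
    rw [show n + (m + 1) = n + 1 + m by ring, show 2 * (m + 1) = 2 * m + 1 + 1 by ring,
      Nat.factorial_succ (2 * m + 1), Nat.factorial_succ (2 * m), Nat.factorial_succ n]
    push_cast
    have h3 : ((2 * (n + 1 + m) + 1).factorial : ℝ) ≠ 0 := by positivity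
    field_simp
    linear_combination (-4 * 4 ^ n * a ^ (2 * (n + 1 + m) + 1)) * hc

theorem hasSum_antidiagonal_of_hasSum_prod {f : ℕ × ℕ → ℝ} {s : ℝ} (h : HasSum f s) :
    HasSum (fun N => ∑ p ∈ Finset.HasAntidiagonal.antidiagonal N, f p) s := by
  refine (Finset.HasAntidiagonal.sigmaAntidiagonalEquivProd.hasSum_iff.2 h).sigma fun N => ?_
  rw [← Finset.sum_coe_sort]
  exact hasSum_fintype _

/-- For |x| ≤ a the double series of the cosine and of the power series is dominated by a product of
two exponential-type series, so it may be integrated term by term. -/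
theorem hasSum_integral_cos_mul_series {d : ℕ → ℝ} (hd : ∀ n, |d n| ≤ 1 / n.factorial)
    (κ ξ : ℝ) {a : ℝ} (ha : 0 ≤ a) :
    HasSum (fun p : ℕ × ℕ => d p.1 * κ ^ p.1 * ((-1) ^ p.2 * ξ ^ (2 * p.2) / (2 * p.2).factorial) *
        ∫ x in -a..a, x ^ (2 * p.2) * (a ^ 2 - x ^ 2) ^ p.1)
      (∫ x in -a..a, Real.cos (ξ * x) * ∑' n, d n * (κ * (a ^ 2 - x ^ 2)) ^ n) := by
  simp only [← intervalIntegral.integral_const_mul]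
  have hs1 : Summable fun n : ℕ => (|κ| * a ^ 2) ^ n / n.factorial :=
    Real.summable_pow_div_factorial _
  have hs2 : Summable fun m : ℕ => (|ξ| * a) ^ (2 * m) / (2 * m).factorial :=
    (Real.summable_pow_div_factorial (|ξ| * a)).comp_injective
      (i := fun m => 2 * m) (mul_right_injective₀ two_ne_zero)
  have hle : -a ≤ a := by linarith
  refine intervalIntegral.hasSum_integral_of_dominated_convergence
    (fun p _ => ((|κ| * a ^ 2) ^ p.1 / p.1.factorial) *
      ((|ξ| * a) ^ (2 * p.2) / (2 * p.2).factorial)) ?_ ?_ ?_ ?_ ?_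
  · exact fun p => Continuous.aestronglyMeasurable (by fun_prop)
  · refine fun p => .of_forall fun x hx => ?_
    rw [uIoc_of_le hle] at hx
    have hxa : |x| ≤ a := abs_le.2 ⟨hx.1.le, hx.2⟩
    have hx2 : |a ^ 2 - x ^ 2| ≤ a ^ 2 := by
      have : x ^ 2 ≤ a ^ 2 := sq_le_sq' hx.1.le hx.2
      rw [abs_of_nonneg (by linarith)]
      nlinarith [sq_nonneg x]
    simp only [norm_mul, norm_pow, norm_div, Real.norm_eq_abs, abs_neg, abs_one, one_pow, one_mul,
      Nat.abs_cast]
    calc _ ≤ 1 / (p.1.factorial : ℝ) * |κ| ^ p.1 * (|ξ| ^ (2 * p.2) / (2 * p.2).factorial) *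
          (a ^ (2 * p.2) * (a ^ 2) ^ p.1) := by gcongr; exact hd _
      _ = _ := by rw [mul_pow, mul_pow]; ring
  · exact .of_forall fun x _ => hs1.mul_of_nonneg hs2 (fun _ => by positivity) fun _ => by positivity
  · exact intervalIntegrable_const
  · refine .of_forall fun x _ => ?_
    have h1 : HasSum (fun n => d n * (κ * (a ^ 2 - x ^ 2)) ^ n) _ :=
      (summable_mul_pow_of_le_inv_factorial hd _).hasSum
    have h2 := Real.hasSum_cos (ξ * x)
    have hs : Summable fun p : ℕ × ℕ => d p.1 * (κ * (a ^ 2 - x ^ 2)) ^ p.1 *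
        ((-1) ^ p.2 * (ξ * x) ^ (2 * p.2) / (2 * p.2).factorial) :=
      summable_mul_of_summable_norm (f := fun n => d n * (κ * (a ^ 2 - x ^ 2)) ^ n)
        (g := fun n : ℕ => (-1) ^ n * (ξ * x) ^ (2 * n) / (2 * n).factorial)
        h1.summable.norm h2.summable.norm
    have h3 := h1.mul h2 hs
    rw [mul_comm (Real.cos _)]
    convert! h3 using 2 with p
    rw [mul_pow, mul_pow, pow_mul]
    ring

theorem sum_antidiagonal_choose_mul_pow (N : ℕ) (x y : ℝ) :
    ∑ p ∈ Finset.HasAntidiagonal.antidiagonal N, (N.choose p.1 : ℝ) * (x ^ p.1 * y ^ p.2) =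
      (x + y) ^ N := by
  rw [(Commute.all x y).add_pow']
  simp only [nsmul_eq_mul]

theorem sum_antidiagonal_choose_succ_mul_pow (N : ℕ) (x y : ℝ) :
    ∑ p ∈ Finset.HasAntidiagonal.antidiagonal N,
        ((N + 1).choose (p.1 + 1) : ℝ) * (x ^ (p.1 + 1) * y ^ p.2) =
      (x + y) ^ (N + 1) - y ^ (N + 1) := by
  rw [← sum_antidiagonal_choose_mul_pow, Finset.Nat.sum_antidiagonal_succ]
  simp

/-- The factors 4ⁿ (n!)² of the Beta integral cancel the Bessel coefficients and the 4 in (lam /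
2c)². What remains on n + m = N is the binomial expansion of (lam² - ξ²c²)^N. -/
theorem integral_cos_mul_besselSeries {c lam T ξ : ℝ} {S : ℝ → ℝ} (hc : 0 < c) (hT : 0 ≤ T)
    (hS : HasSum (fun n : ℕ => (lam ^ 2 - (ξ * c) ^ 2) ^ n *
      (T ^ (2 * n + 1) / (2 * n + 1).factorial)) (S T)) :
    ∫ x in -(c * T)..c * T, Real.cos (ξ * x) *
      besselSeries ((lam / (2 * c)) ^ 2 * ((c * T) ^ 2 - x ^ 2)) = 2 * c * S T := by
  have h := hasSum_antidiagonal_of_hasSum_prod (hasSum_integral_cos_mul_series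
    abs_besselSeries_coeff_le ((lam / (2 * c)) ^ 2) ξ (a := c * T) (by positivity))
  refine h.unique ?_
  convert! hS.mul_left (2 * c) using 2 with N
  rw [sub_eq_add_neg, ← sum_antidiagonal_choose_mul_pow, Finset.sum_mul, Finset.mul_sum]
  refine Finset.sum_congr rfl fun p hp => ?_
  obtain ⟨n, m⟩ := p
  obtain rfl : n + m = N := by simpa using hp
  have h4 : ((2 : ℝ) ^ 2) ^ n = 4 ^ n := by norm_num
  rw [integral_even_pow_mul_pow_sub_sq, neg_pow ((ξ * c) ^ 2), ← pow_mul, ← pow_mul, ← pow_mul,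
    div_pow, mul_pow, mul_pow, mul_pow, pow_mul 2 2 n]
  simp only [h4]
  field_simp
  ring

/-- The coefficient 1 / (n! (n+1)!) turns the binomial coefficients into those of order N + 1 with
lower index at least 1. The missing terms of lower index 0 form the cosine series, which is why a
cosine is subtracted on the right. -/
theorem integral_cos_mul_besselSeriesDeriv {c lam T ξ : ℝ} {C : ℝ → ℝ} (hc : 0 < c) (hT : 0 ≤ T)
    (hC : HasSum (fun n : ℕ => (lam ^ 2 - (ξ * c) ^ 2) ^ n *
      (T ^ (2 * n) / (2 * n).factorial)) (C T)) :
    ∫ x in -(c * T)..c * T, Real.cos (ξ * x) *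
      (lam ^ 2 * T / 2 * besselSeriesDeriv ((lam / (2 * c)) ^ 2 * ((c * T) ^ 2 - x ^ 2))) =
      2 * c * (C T - Real.cos (ξ * (c * T))) := by
  have h := hasSum_antidiagonal_of_hasSum_prod (hasSum_integral_cos_mul_series
    abs_besselSeriesDeriv_coeff_le ((lam / (2 * c)) ^ 2) ξ (a := c * T) (by positivity))
  replace h := h.mul_left (lam ^ 2 * T / 2)
  rw [← intervalIntegral.integral_const_mul] at h
  have hcos := Real.hasSum_cos (ξ * (c * T))
  have hd := (hC.sub hcos).mul_left (2 * c)
  -- The constant terms of `C` and of the cosine are both 1 and cancel, so the difference starts at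
  -- order 1.
  rw [← hasSum_nat_add_iff' 1] at hd
  simp only [Finset.range_one, Finset.sum_singleton, mul_zero, pow_zero, Nat.factorial_zero,
    Nat.cast_one, div_one, mul_one, sub_self, sub_zero] at hd
  have hrw : ∫ x in -(c * T)..c * T, Real.cos (ξ * x) *
      (lam ^ 2 * T / 2 * besselSeriesDeriv ((lam / (2 * c)) ^ 2 * ((c * T) ^ 2 - x ^ 2))) =
      ∫ x in -(c * T)..c * T, lam ^ 2 * T / 2 * (Real.cos (ξ * x) *
        ∑' n : ℕ, 1 / ((n.factorial : ℝ) * (n + 1).factorial) *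
          ((lam / (2 * c)) ^ 2 * ((c * T) ^ 2 - x ^ 2)) ^ n) :=
    intervalIntegral.integral_congr fun x _ => by simp only [besselSeriesDeriv]; ring
  rw [hrw]
  refine h.unique ?_
  convert! hd using 2 with N
  have hsum : (lam ^ 2 - (ξ * c) ^ 2) ^ (N + 1) * (T ^ (2 * (N + 1)) / (2 * (N + 1)).factorial) -
      (-1) ^ (N + 1) * (ξ * (c * T)) ^ (2 * (N + 1)) / (2 * (N + 1)).factorial =
      ((lam ^ 2 + -(ξ * c) ^ 2) ^ (N + 1) - (-(ξ * c) ^ 2) ^ (N + 1)) *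
        (T ^ (2 * (N + 1)) / (2 * (N + 1)).factorial) := by
    rw [neg_pow ((ξ * c) ^ 2), ← mul_assoc, mul_pow (ξ * c), pow_mul (ξ * c)]
    ring
  rw [hsum, ← sum_antidiagonal_choose_succ_mul_pow, Finset.sum_mul, Finset.mul_sum, Finset.mul_sum]
  refine Finset.sum_congr rfl fun p hp => ?_
  obtain ⟨n, m⟩ := p
  obtain rfl : n + m = N := by simpa using hp
  have hch : ((n + m + 1).choose (n + 1) : ℝ) * (n + 1) = (n + m + 1) * (n + m).choose n := by
    have := Nat.add_one_mul_choose_eq (n + m) n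
    exact_mod_cast this.symm
  have h4 : ((2 : ℝ) ^ 2) ^ n = 4 ^ n := by norm_num
  rw [integral_even_pow_mul_pow_sub_sq, neg_pow ((ξ * c) ^ 2), ← pow_mul, ← pow_mul, ← pow_mul,
    div_pow, mul_pow, mul_pow, mul_pow, pow_mul 2 2 n,
    show 2 * (n + m + 1) = 2 * (n + m) + 1 + 1 by ring,
    Nat.factorial_succ (2 * (n + m) + 1), Nat.factorial_succ n]
  push_cast
  simp only [h4]
  field_simp
  linear_combination (-2 * lam ^ (2 * n + 2) * T ^ (2 * (n + m) + 2) * ξ ^ (2 * m) *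
    c ^ (2 * (n + m) + 1)) * hch

/-! ### The candidate law and its characteristic function. -/

/-- The density of the absolutely continuous part of the law at time `T` of the telegraph process
with velocity `c` and rate `lam`, on `|x| < c T`. -/
noncomputable def classicalDensity (c lam T x : ℝ) : ℝ :=
  Real.exp (-lam * T) / 2 *
    (lam / c * besselSeries ((lam / (2 * c)) ^ 2 * ((c * T) ^ 2 - x ^ 2)) +
      1 / c * (lam ^ 2 * T / 2 *
        besselSeriesDeriv ((lam / (2 * c)) ^ 2 * ((c * T) ^ 2 - x ^ 2))))

theorem continuous_classicalDensity (c lam T : ℝ) : Continuous (classicalDensity c lam T) := by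
  have h1 := continuous_besselSeries
  have h2 := continuous_besselSeriesDeriv
  unfold classicalDensity
  fun_prop

theorem classicalDensity_nonneg {c lam T x : ℝ} (hc : 0 < c) (hlam : 0 ≤ lam) (hT : 0 ≤ T)
    (hx : |x| ≤ c * T) : 0 ≤ classicalDensity c lam T x := by
  have h : 0 ≤ (lam / (2 * c)) ^ 2 * ((c * T) ^ 2 - x ^ 2) :=
    mul_nonneg (sq_nonneg _) (sub_nonneg.2 (sq_le_sq' (abs_le.1 hx).1 (abs_le.1 hx).2))
  have h1 := besselSeries_nonneg h
  have h2 := besselSeriesDeriv_nonneg h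
  unfold classicalDensity
  positivity

/-- The law at time `T` of the telegraph process with velocity `c` and rate `lam`. -/
noncomputable def classicalLaw (c lam T : ℝ) : Measure ℝ :=
  (volume.restrict {x : ℝ | |x| < c * T}).withDensity
      (fun x => ENNReal.ofReal (classicalDensity c lam T x)) +
    ENNReal.ofReal (Real.exp (-lam * T) / 2) •
      (Measure.dirac (c * T) + Measure.dirac (-(c * T)))

theorem setOf_abs_lt_eq_Ioo (a : ℝ) : {x : ℝ | |x| < a} = Ioo (-a) a := by
  ext x
  simp [abs_lt]

theorem integrable_classicalDensity (c lam T : ℝ) :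
    Integrable (classicalDensity c lam T) (volume.restrict {x : ℝ | |x| < c * T}) := by
  rw [setOf_abs_lt_eq_Ioo]
  exact ((continuous_classicalDensity c lam T).integrableOn_Icc).mono_set Ioo_subset_Icc_self

theorem isFiniteMeasure_withDensity_classicalDensity (c lam T : ℝ) :
    IsFiniteMeasure ((volume.restrict {x : ℝ | |x| < c * T}).withDensity
      (fun x => ENNReal.ofReal (classicalDensity c lam T x))) :=
  isFiniteMeasure_withDensity_ofReal (integrable_classicalDensity c lam T).2

theorem isFiniteMeasure_smul_dirac_add_dirac (p a b : ℝ) :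
    IsFiniteMeasure (ENNReal.ofReal p • (Measure.dirac a + Measure.dirac b : Measure ℝ)) :=
  Measure.smul_finite _ ENNReal.ofReal_ne_top

instance isFiniteMeasure_classicalLaw (c lam T : ℝ) : IsFiniteMeasure (classicalLaw c lam T) := by
  have h1 := isFiniteMeasure_withDensity_classicalDensity c lam T
  have h2 := isFiniteMeasure_smul_dirac_add_dirac (Real.exp (-lam * T) / 2) (c * T) (-(c * T))
  unfold classicalLaw
  infer_instance

theorem integral_cos_mul_classicalDensity {c lam T ξ : ℝ} {C S : ℝ → ℝ} (hc : 0 < c) (hT : 0 ≤ T)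
    (hC : HasSum (fun n : ℕ => (lam ^ 2 - (ξ * c) ^ 2) ^ n *
      (T ^ (2 * n) / (2 * n).factorial)) (C T))
    (hS : HasSum (fun n : ℕ => (lam ^ 2 - (ξ * c) ^ 2) ^ n *
      (T ^ (2 * n + 1) / (2 * n + 1).factorial)) (S T)) :
    ∫ x in -(c * T)..c * T, classicalDensity c lam T x * Real.cos (ξ * x) =
      Real.exp (-lam * T) * (C T + lam * S T - Real.cos (ξ * (c * T))) := by
  have h1 := integral_cos_mul_besselSeries hc hT hS
  have h2 := integral_cos_mul_besselSeriesDeriv hc hT hC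
  have hb1 := continuous_besselSeries
  have hb2 := continuous_besselSeriesDeriv
  have : ∀ x, classicalDensity c lam T x * Real.cos (ξ * x) = Real.exp (-lam * T) / 2 * (lam / c) *
      (Real.cos (ξ * x) * besselSeries ((lam / (2 * c)) ^ 2 * ((c * T) ^ 2 - x ^ 2))) +
      Real.exp (-lam * T) / 2 * (1 / c) * (Real.cos (ξ * x) *
      (lam ^ 2 * T / 2 * besselSeriesDeriv ((lam / (2 * c)) ^ 2 * ((c * T) ^ 2 - x ^ 2)))) :=
    fun x => by unfold classicalDensity; ring
  simp only [this]
  rw [intervalIntegral.integral_add (Continuous.intervalIntegrable (by fun_prop) _ _)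
    (Continuous.intervalIntegrable (by fun_prop) _ _), intervalIntegral.integral_const_mul,
    intervalIntegral.integral_const_mul, h1, h2]
  field_simp
  ring

theorem integral_sin_mul_classicalDensity (c lam T ξ : ℝ) :
    ∫ x in -(c * T)..c * T, classicalDensity c lam T x * Real.sin (ξ * x) = 0 := by
  have h := intervalIntegral.integral_comp_neg (a := -(c * T)) (b := c * T)
    fun x => classicalDensity c lam T x * Real.sin (ξ * x)
  have h2 : ∀ x, classicalDensity c lam T (-x) * Real.sin (ξ * -x) =
      -(classicalDensity c lam T x * Real.sin (ξ * x)) := fun x => by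
    simp [classicalDensity]
  simp only [h2, neg_neg, intervalIntegral.integral_neg] at h
  linarith

/-- The density is even, so its sine transform vanishes. The two atoms contribute exp(-lam T) cos(ξ
c T), exactly the term subtracted in the cosine transform of the density. -/
theorem charFun_classicalLaw {c lam T ξ : ℝ} {C S : ℝ → ℝ} (hc : 0 < c) (hlam : 0 ≤ lam)
    (hT : 0 ≤ T)
    (hC : HasSum (fun n : ℕ => (lam ^ 2 - (ξ * c) ^ 2) ^ n *
      (T ^ (2 * n) / (2 * n).factorial)) (C T))
    (hS : HasSum (fun n : ℕ => (lam ^ 2 - (ξ * c) ^ 2) ^ n *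
      (T ^ (2 * n + 1) / (2 * n + 1).factorial)) (S T)) :
    charFun (classicalLaw c lam T) ξ = (Real.exp (-lam * T) * (C T + lam * S T) : ℝ) := by
  have hq := continuous_classicalDensity c lam T
  have hle : -(c * T) ≤ c * T := by nlinarith
  have hac : ∫ x, Complex.exp (ξ * x * Complex.I)
      ∂((volume.restrict {x : ℝ | |x| < c * T}).withDensity
        (fun x => ENNReal.ofReal (classicalDensity c lam T x))) =
      (Real.exp (-lam * T) * (C T + lam * S T - Real.cos (ξ * (c * T))) : ℝ) := by
    rw [integral_withDensity_eq_integral_toReal_smul (by fun_prop)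
      (.of_forall fun _ => ENNReal.ofReal_lt_top)]
    have h1 : ∫ x in {x : ℝ | |x| < c * T}, (ENNReal.ofReal (classicalDensity c lam T x)).toReal •
        Complex.exp (ξ * x * Complex.I) = ∫ x in -(c * T)..c * T,
          (((classicalDensity c lam T x * Real.cos (ξ * x) : ℝ) : ℂ) +
            ((classicalDensity c lam T x * Real.sin (ξ * x) : ℝ) : ℂ) * Complex.I) := by
      rw [intervalIntegral.integral_of_le hle, setOf_abs_lt_eq_Ioo, integral_Ioc_eq_integral_Ioo]
      refine setIntegral_congr_fun measurableSet_Ioo fun x hx => ?_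
      rw [ENNReal.toReal_ofReal (classicalDensity_nonneg hc hlam hT (abs_le.2 ⟨hx.1.le, hx.2.le⟩)),
        Complex.exp_mul_I, Complex.real_smul]
      push_cast
      ring
    rw [h1, intervalIntegral.integral_add (Continuous.intervalIntegrable (by fun_prop) _ _)
      (Continuous.intervalIntegrable (by fun_prop) _ _), intervalIntegral.integral_mul_const,
      intervalIntegral.integral_ofReal, intervalIntegral.integral_ofReal,
      integral_sin_mul_classicalDensity, integral_cos_mul_classicalDensity hc hT hC hS]
    simp
  have hi : ∀ μ : Measure ℝ, IsFiniteMeasure μ →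
      Integrable (fun x : ℝ => Complex.exp (ξ * x * Complex.I)) μ := fun μ _ => by
    refine Integrable.of_bound (C := 1) (by fun_prop) (.of_forall fun x => ?_)
    rw [← Complex.ofReal_mul, Complex.norm_exp_ofReal_mul_I]
  rw [charFun_apply_real, classicalLaw, integral_add_measure
    (hi _ (isFiniteMeasure_withDensity_classicalDensity c lam T))
    (hi _ (isFiniteMeasure_smul_dirac_add_dirac _ _ _)), hac, integral_smul_measure,
    integral_add_measure (hi _ inferInstance) (hi _ inferInstance), integral_dirac, integral_dirac,
    ENNReal.toReal_ofReal (by positivity)]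
  rw [Complex.exp_mul_I, Complex.exp_mul_I, Complex.real_smul]
  push_cast
  simp only [mul_neg, Complex.cos_neg, Complex.sin_neg]
  ring

/-! ### Approximating the position by finitely many values of the path. -/

/-- Rounding up to the grid of mesh r / n approaches s from the right, the only side on which the
paths are continuous. -/
theorem tendsto_mul_ceil_div_nhdsWithin {r : ℝ≥0} (hr : 0 < r) (s : ℝ≥0) :
    Filter.Tendsto (fun n : ℕ => r * (⌈(s : ℝ) / r * n⌉₊ : ℝ≥0) / n) Filter.atTop
      (nhdsWithin s (Ici s)) := by
  have hr' : (0 : ℝ) < r := hr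
  refine tendsto_nhdsWithin_iff.2 ⟨?_, ?_⟩
  · rw [← NNReal.tendsto_coe]
    have h := ((tendsto_nat_ceil_mul_div_atTop (R := ℝ) (a := (s : ℝ) / r) (by positivity)).comp
      tendsto_natCast_atTop_atTop).const_mul (r : ℝ)
    rw [mul_div_cancel₀ _ hr'.ne'] at h
    refine h.congr fun n => ?_
    push_cast
    simp only [Function.comp]
    ring
  · filter_upwards [Filter.eventually_gt_atTop 0] with n hn
    have hn' : (0 : ℝ) < n := by exact_mod_cast hn
    rw [mem_Ici, ← NNReal.coe_le_coe]
    push_cast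
    rw [le_div_iff₀ hn']
    calc (s : ℝ) * n = r * ((s : ℝ) / r * n) := by field_simp
      _ ≤ _ := by gcongr; exact Nat.le_ceil _

/-- The signed integral of `c` along the counting path `f`: the position at time `t` of a particle
with speed `c`, initially moving to the right, which turns around at every jump of `f`. -/
noncomputable def pathPosition (c : ℝ → ℝ) (f : ℝ≥0 → ℕ) (t : ℝ) : ℝ :=
  ∫ s in (0 : ℝ)..t, c s * (-1) ^ f s.toNNReal

/-- The approximation of `pathPosition` which uses the values of `f` at `n` times only. -/
noncomputable def pathSum (c : ℝ → ℝ) (r : ℝ≥0) (n : ℕ) (f : ℝ≥0 → ℕ) : ℝ :=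
  ∑ k ∈ Finset.range n, (∫ s in (r * k / n : ℝ)..r * (k + 1 : ℕ) / n, c s) *
    (-1) ^ f (r * (k + 1 : ℕ) / n)

theorem abs_neg_one_pow_le (k : ℕ) : |(-1 : ℝ) ^ k| ≤ 1 := by simp

theorem ceil_div_mul_eq {r : ℝ≥0} {n k : ℕ} {s : ℝ} (hr : 0 < r) (hn : 0 < n)
    (hs : s ∈ Ioc (r * k / n : ℝ) (r * (k + 1 : ℕ) / n)) : ⌈s / r * n⌉₊ = k + 1 := by
  have hr' : (0 : ℝ) < r := hr
  have hn' : (0 : ℝ) < n := by exact_mod_cast hn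
  rw [Nat.ceil_eq_iff (Nat.succ_ne_zero k)]
  obtain ⟨h1, h2⟩ := hs
  rw [div_lt_iff₀ hn'] at h1
  rw [le_div_iff₀ hn'] at h2
  rw [div_mul_eq_mul_div, lt_div_iff₀ hr', div_le_iff₀ hr']
  constructor
  · rw [Nat.succ_sub_one]
    linarith
  · linarith

theorem intervalIntegrable_mul_comp_ceil {c : ℝ → ℝ} {a b : ℝ} (hc : IntervalIntegrable c volume a b)
    (x : ℝ) (g : ℕ → ℕ) :
    IntervalIntegrable (fun s => c s * (-1) ^ g ⌈s * x⌉₊) volume a b := by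
  refine hc.mul_of_abs_le_one ?_ fun _ => abs_neg_one_pow_le _
  exact (measurable_of_countable fun k : ℕ => (-1 : ℝ) ^ g k).comp
    (Nat.measurable_ceil.comp (measurable_id.mul_const x))

theorem pathSum_eq_integral {c : ℝ → ℝ} (hc : ∀ a b, IntervalIntegrable c volume a b) {r : ℝ≥0}
    (hr : 0 < r) {n : ℕ} (hn : 0 < n) (f : ℝ≥0 → ℕ) :
    pathSum c r n f = ∫ s in (0 : ℝ)..r, c s * (-1) ^ f (r * (⌈s / r * n⌉₊ : ℝ≥0) / n) := by
  have hn' : (0 : ℝ) < n := by exact_mod_cast hn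
  have hint : ∀ a b, IntervalIntegrable
      (fun s => c s * (-1) ^ f (r * (⌈s / r * n⌉₊ : ℝ≥0) / n)) volume a b := fun a b => by
    have := intervalIntegrable_mul_comp_ceil (hc a b) (n / r) fun k => f (r * k / n)
    simpa only [div_mul_eq_mul_div, mul_div_assoc] using this
  have h := intervalIntegral.sum_integral_adjacent_intervals (n := n)
    (a := fun k : ℕ => (r * k / n : ℝ)) fun k _ => hint (r * k / n) (r * (k + 1 : ℕ) / n)
  simp only [Nat.cast_zero, mul_zero, zero_div, mul_div_cancel_right₀ (r : ℝ) hn'.ne'] at h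
  rw [← h]
  refine Finset.sum_congr rfl fun k _ => ?_
  rw [← intervalIntegral.integral_mul_const]
  have hle : (r * k / n : ℝ) ≤ r * (k + 1 : ℕ) / n := by gcongr; simp
  refine intervalIntegral.integral_congr_ae (.of_forall fun s hs => ?_)
  rw [uIoc_of_le hle] at hs
  rw [ceil_div_mul_eq hr hn hs]

/-- Right-continuity gives pointwise convergence of the integrands, and |c| dominates them. The
limit carries over independence, which is directly available only for finitely many times. -/
theorem tendsto_pathSum {c : ℝ → ℝ} (hc : ∀ a b, IntervalIntegrable c volume a b)
    {f : ℝ≥0 → ℕ} (hf : ∀ t, ContinuousWithinAt f (Ici t) t) (r : ℝ≥0) :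
    Filter.Tendsto (fun n => pathSum c r n f) Filter.atTop (nhds (pathPosition c f r)) := by
  rcases eq_or_ne r 0 with rfl | hr
  · simp [pathSum, pathPosition]
  replace hr : 0 < r := pos_iff_ne_zero.2 hr
  have h : Filter.Tendsto (fun n : ℕ => ∫ s in (0 : ℝ)..r,
      c s * (-1) ^ f (r * (⌈s / r * n⌉₊ : ℝ≥0) / n)) Filter.atTop
        (nhds (pathPosition c f r)) := by
    refine intervalIntegral.tendsto_integral_filter_of_dominated_convergence (fun s => ‖c s‖)
      (.of_forall fun n => ?_) (.of_forall fun n => .of_forall fun s _ => ?_) (hc 0 r).norm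
      (.of_forall fun s hs => ?_)
    · have := intervalIntegrable_mul_comp_ceil (hc 0 r) (n / r) fun k => f (r * k / n)
      refine (intervalIntegrable_iff.1 ?_).aestronglyMeasurable
      simpa only [div_mul_eq_mul_div, mul_div_assoc] using this
    · rw [norm_mul]
      exact mul_le_of_le_one_right (norm_nonneg _) (abs_neg_one_pow_le _)
    · rw [uIoc_of_le r.coe_nonneg] at hs
      have h1 := tendsto_mul_ceil_div_nhdsWithin hr s.toNNReal
      rw [Real.coe_toNNReal _ hs.1.le] at h1
      have h2 := (hf s.toNNReal).tendsto.comp h1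
      exact (((continuous_of_discreteTopology (f := fun k : ℕ => (-1 : ℝ) ^ k)).tendsto _).comp
        h2).const_mul _
  refine h.congr' ?_
  filter_upwards [Filter.eventually_gt_atTop 0] with n hn
  exact (pathSum_eq_integral hc hr hn f).symm

theorem measurable_pathSum (c : ℝ → ℝ) (r : ℝ≥0) (n : ℕ) : Measurable (pathSum c r n) := by
  refine Finset.measurable_fun_sum _ fun k _ => Measurable.const_mul ?_ _
  exact (measurable_of_countable fun k : ℕ => (-1 : ℝ) ^ k).comp (measurable_pi_apply _)

/-! ### Joint measurability in time and outcome. -/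

section Regular

variable {Ω : Type*} [MeasurableSpace Ω] {P : Measure Ω} {N : ℝ≥0 → Ω → ℕ} {c : ℝ → ℝ}

theorem measurable_eval_comp_of_countable (hm : ∀ t, Measurable (N t)) (T : ℕ → ℝ≥0)
    {k : ℝ × Ω → ℕ} (hk : Measurable k) : Measurable fun p : ℝ × Ω => N (T (k p)) p.2 := by
  have h : Measurable fun p : ℕ × Ω => N (T p.1) p.2 :=
    measurable_from_prod_countable_right fun k => hm (T k)
  exact h.comp (hk.prodMk measurable_snd)

theorem measurable_uncurry_of_rightContinuous (hm : ∀ t, Measurable (N t))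
    (hrc : ∀ ω t, ContinuousWithinAt (fun s => N s ω) (Ici t) t) :
    Measurable fun p : ℝ × Ω => N p.1.toNNReal p.2 := by
  refine measurable_of_tendsto_metrizable (f := fun (n : ℕ) (p : ℝ × Ω) =>
    N (1 * (⌈(p.1.toNNReal : ℝ) / (1 : ℝ≥0) * n⌉₊ : ℝ≥0) / n) p.2) (fun n => ?_)
    (tendsto_pi_nhds.2 fun p => ?_)
  · have h2 : Measurable fun p : ℝ × Ω => ⌈(p.1.toNNReal : ℝ) / (1 : ℝ≥0) * n⌉₊ :=
      Nat.measurable_ceil.comp (by fun_prop)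
    exact measurable_eval_comp_of_countable hm (fun k => 1 * k / n) h2
  · exact (hrc p.2 p.1.toNNReal).tendsto.comp
      (tendsto_mul_ceil_div_nhdsWithin one_pos p.1.toNNReal)

theorem measurable_parity (hm : ∀ t, Measurable (N t))
    (hrc : ∀ ω t, ContinuousWithinAt (fun s => N s ω) (Ici t) t) :
    Measurable fun p : ℝ × Ω => (-1 : ℝ) ^ N p.1.toNNReal p.2 :=
  (measurable_of_countable fun k : ℕ => (-1 : ℝ) ^ k).comp
    (measurable_uncurry_of_rightContinuous hm hrc)

theorem intervalIntegrable_mul_parity (hc : ∀ a b, IntervalIntegrable c volume a b)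
    (hm : ∀ t, Measurable (N t)) (hrc : ∀ ω t, ContinuousWithinAt (fun s => N s ω) (Ici t) t)
    (ω : Ω) (a b : ℝ) :
    IntervalIntegrable (fun s => c s * (-1) ^ N s.toNNReal ω) volume a b :=
  (hc a b).mul_of_abs_le_one ((measurable_parity hm hrc).comp measurable_prodMk_right)
    fun _ => abs_neg_one_pow_le _

/-- The position is continuous in time and measurable in the outcome, hence jointly measurable. -/
theorem measurable_uncurry_pathPosition (hc : ∀ a b, IntervalIntegrable c volume a b)
    (hcm : Measurable c) (hm : ∀ t, Measurable (N t))
    (hrc : ∀ ω t, ContinuousWithinAt (fun s => N s ω) (Ici t) t) :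
    Measurable fun p : ℝ × Ω => pathPosition c (fun s => N s p.2) p.1 := by
  refine measurable_uncurry_of_continuous_of_measurable
    (u := fun (t : ℝ) ω => pathPosition c (fun s => N s ω) t) (fun ω => ?_) fun t => ?_
  · exact intervalIntegral.continuous_primitive (intervalIntegrable_mul_parity hc hm hrc ω) 0
  · have h : StronglyMeasurable fun p : Ω × ℝ => c p.2 * (-1) ^ N p.2.toNNReal p.1 :=
      ((hcm.comp measurable_snd).mul
        ((measurable_parity hm hrc).comp measurable_swap)).stronglyMeasurable
    simp only [pathPosition, intervalIntegral]
    exact (h.integral_prod_right.sub h.integral_prod_right).measurable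

end Regular

/-! ### Parity of Poisson increments and independence of the past. -/

/-- A Poisson process all of whose paths start at `0`, are nondecreasing and right-continuous. -/
structure IsRegularPoissonProcess {Ω : Type*} [MeasurableSpace Ω] (rate : ℝ → ℝ)
    (N : ℝ≥0 → Ω → ℕ) (P : Measure Ω) : Prop extends IsPoissonProcess rate N P where
  zero_apply : ∀ ω, N 0 ω = 0
  monotone_apply : ∀ ω, Monotone fun t => N t ω
  rightContinuous_apply : ∀ ω t, ContinuousWithinAt (fun s => N s ω) (Ici t) t

theorem integral_neg_one_pow_poissonMeasure (m : ℝ≥0) :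
    ∫ k, (-1 : ℝ) ^ k ∂poissonMeasure m = Real.exp (-2 * m) := by
  rw [integral_poissonMeasure]
  have h := (NormedSpace.expSeries_div_hasSum_exp (-(m : ℝ))).mul_left (Real.exp (-m))
  rw [← Real.exp_eq_exp_ℝ, ← Real.exp_add] at h
  rw [show -2 * (m : ℝ) = -m + -m by ring, ← h.tsum_eq]
  refine tsum_congr fun k => ?_
  rw [neg_pow (m : ℝ), smul_eq_mul]
  ring

theorem IndepFun.integral_comp_mul_comp_eq {Ω : Type*} [MeasurableSpace Ω] {P : Measure Ω}
    {α β : Type*} [MeasurableSpace α] [MeasurableSpace β] {A : Ω → α} {B : Ω → β} {f : α → ℝ}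
    {g : β → ℝ} (h : IndepFun A B P) (hA : Measurable A) (hB : Measurable B) (hf : Measurable f)
    (hg : Measurable g) :
    ∫ ω, f (A ω) * g (B ω) ∂P = (∫ ω, f (A ω) ∂P) * ∫ ω, g (B ω) ∂P :=
  (h.comp hf hg).integral_fun_mul_eq_mul_integral (hf.comp hA).aestronglyMeasurable
    (hg.comp hB).aestronglyMeasurable

section

variable {Ω : Type*} [MeasurableSpace Ω] {P : Measure Ω} {N : ℝ≥0 → Ω → ℕ} {rate c : ℝ → ℝ}

theorem IsPoissonProcess.integral_neg_one_pow_sub (hN : IsPoissonProcess rate N P) {s t : ℝ≥0}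
    (hst : s ≤ t) (hrate : 0 ≤ ∫ u in (s : ℝ)..t, rate u) :
    ∫ ω, (-1 : ℝ) ^ (N t ω - N s ω) ∂P = Real.exp (-2 * ∫ u in (s : ℝ)..t, rate u) := by
  have h := integral_map (μ := P) (φ := fun ω => N t ω - N s ω) (f := fun k : ℕ => (-1 : ℝ) ^ k)
    ((hN.measurable t).sub (hN.measurable s)).aemeasurable
    (measurable_of_countable _).aestronglyMeasurable
  rw [← h, hN.increments s t hst, integral_neg_one_pow_poissonMeasure, Real.coe_toNNReal _ hrate]

theorem measurable_pathSum_apply (hm : ∀ t, Measurable (N t)) (r : ℝ≥0) (n : ℕ) :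
    Measurable fun ω => pathSum c r n fun s => N s ω :=
  (measurable_pathSum c r n).comp (measurable_pi_lambda _ hm)

/-- The increments of a Poisson process after `r` are independent of its past. -/
theorem IsRegularPoissonProcess.indepFun_sub_pathSum (hN : IsRegularPoissonProcess rate N P)
    {r t : ℝ≥0} (hrt : r ≤ t) {n : ℕ} (hn : 0 < n) :
    IndepFun (fun ω => N t ω - N r ω) (fun ω => pathSum c r n fun s => N s ω) P := by
  -- The grid of [0, r], then the constant `t`: `T n = r` and `T (n + 1) = t`, so the increment of
  -- index n is the one after `r`, and those of smaller index lie in the past.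
  set T : ℕ → ℝ≥0 := fun k => if k ≤ n then r * k / n else t with hT
  have hn' : (0 : ℝ≥0) < n := by exact_mod_cast hn
  have hTle : ∀ k ≤ n, T k ≤ r := fun k hk => by
    simp only [hT, if_pos hk]
    rw [div_le_iff₀ hn']
    gcongr
  have hmono : Monotone T := by
    refine monotone_nat_of_le_succ fun k => ?_
    by_cases hk : k + 1 ≤ n
    · simp only [hT, if_pos hk, if_pos (Nat.le_of_succ_le hk)]
      gcongr
      simp
    · have : T (k + 1) = t := by simp only [hT, if_neg hk]
      rw [this]
      by_cases hk' : k ≤ n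
      · exact (hTle k hk').trans hrt
      · simp [hT, if_neg hk']
  have hind := (hN.indepIncrements.nat hmono).indepFun_finset {n} (Finset.range n) (by simp)
    fun i => (hN.measurable _).sub (hN.measurable _)
  -- Since the count starts at 0, its value at a grid time is the sum of the preceding increments.
  -- The default 0 is never reached, because i ≤ k < n.
  let g : (Finset.range n → ℕ) → ℝ := fun x =>
    ∑ k ∈ Finset.range n, (∫ s in (r * k / n : ℝ)..r * (k + 1 : ℕ) / n, c s) *
      (-1) ^ ∑ i ∈ Finset.range (k + 1), if h : i ∈ Finset.range n then x ⟨i, h⟩ else 0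
  have hlast : Measurable fun x : ({n} : Finset ℕ) → ℕ => x ⟨n, Finset.mem_singleton_self n⟩ :=
    measurable_of_countable _
  have hcomp := hind.comp hlast (measurable_of_countable g)
  have h1 : (fun ω => N t ω - N r ω) = (fun x : ({n} : Finset ℕ) → ℕ =>
      x ⟨n, Finset.mem_singleton_self n⟩) ∘ fun ω (i : ({n} : Finset ℕ)) =>
        N (T (i + 1)) ω - N (T i) ω := by
    funext ω
    simp [hT, mul_div_cancel_right₀ r hn'.ne']
  have h2 : (fun ω => pathSum c r n fun s => N s ω) = g ∘ fun ω (i : Finset.range n) =>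
      N (T (i + 1)) ω - N (T i) ω := by
    funext ω
    refine Finset.sum_congr rfl fun k hk => ?_
    have hk' := Finset.mem_range.1 hk
    congr 2
    have hsum : ∑ i ∈ Finset.range (k + 1), (if h : i ∈ Finset.range n then
        N (T (i + 1)) ω - N (T i) ω else 0) =
        ∑ i ∈ Finset.range (k + 1), (N (T (i + 1)) ω - N (T i) ω) := by
      refine Finset.sum_congr rfl fun i hi => dif_pos ?_
      rw [Finset.mem_range] at hi ⊢
      omega
    have htel := Finset.sum_range_tsub (f := fun i => N (T i) ω)
      (fun a b hab => hN.monotone_apply ω (hmono hab)) (k + 1)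
    have hT0 : T 0 = 0 := by simp [hT]
    rw [hT0, hN.zero_apply, Nat.sub_zero] at htel
    refine Eq.trans ?_ (hsum.trans htel).symm
    simp only [hT, if_pos (Nat.succ_le_of_lt hk')]
  rw [h1, h2]
  exact hcomp

theorem IsRegularPoissonProcess.tendsto_pathSum (hN : IsRegularPoissonProcess rate N P)
    (hc : ∀ a b, IntervalIntegrable c volume a b) (r : ℝ≥0) (ω : Ω) :
    Filter.Tendsto (fun n => pathSum c r n fun s => N s ω) Filter.atTop
      (nhds (pathPosition c (fun s => N s ω) r)) :=
  _root_.tendsto_pathSum hc (hN.rightContinuous_apply ω) r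

/-- Bounded convergence along the approximations of the position. -/
theorem IsRegularPoissonProcess.tendsto_integral_mul_comp_pathSum [IsProbabilityMeasure P]
    (hN : IsRegularPoissonProcess rate N P) (hc : ∀ a b, IntervalIntegrable c volume a b) (r : ℝ≥0)
    {A : Ω → ℝ} (hA : AEStronglyMeasurable A P) (hA1 : ∀ᵐ ω ∂P, |A ω| ≤ 1) {F : ℝ → ℝ}
    (hF : Continuous F) (hF1 : ∀ x, |F x| ≤ 1) :
    Filter.Tendsto (fun n => ∫ ω, A ω * F (pathSum c r n fun s => N s ω) ∂P) Filter.atTop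
      (nhds (∫ ω, A ω * F (pathPosition c (fun s => N s ω) r) ∂P)) := by
  refine tendsto_integral_of_dominated_convergence (fun _ => 1) (fun n => ?_)
    (integrable_const 1) (fun n => ?_) (.of_forall fun ω => ?_)
  · exact hA.mul (hF.measurable.comp
      (measurable_pathSum_apply hN.measurable r n)).aestronglyMeasurable
  · filter_upwards [hA1] with ω hω
    rw [norm_mul]
    exact mul_le_one₀ hω (norm_nonneg _) (hF1 _)
  · exact ((hF.tendsto _).comp (hN.tendsto_pathSum hc r ω)).const_mul _

/-- The two parities multiply to the parity of N(t) - N(r), which is independent of every path sum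
up to `r`. The expectation factors for the path sums, and bounded convergence passes this to the
position. -/
theorem IsRegularPoissonProcess.integral_parity_mul_parity_mul_comp [IsProbabilityMeasure P]
    (hN : IsRegularPoissonProcess rate N P) (hc : ∀ a b, IntervalIntegrable c volume a b)
    {r t : ℝ≥0} (hrt : r ≤ t) (hrate : 0 ≤ ∫ u in (r : ℝ)..t, rate u) {F : ℝ → ℝ}
    (hF : Continuous F) (hF1 : ∀ x, |F x| ≤ 1) :
    ∫ ω, (-1 : ℝ) ^ N t ω * ((-1) ^ N r ω * F (pathPosition c (fun s => N s ω) r)) ∂P =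
      Real.exp (-2 * ∫ u in (r : ℝ)..t, rate u) *
        ∫ ω, F (pathPosition c (fun s => N s ω) r) ∂P := by
  have hpow : Measurable fun k : ℕ => (-1 : ℝ) ^ k := measurable_of_countable _
  have hsub : Measurable fun ω => N t ω - N r ω := (hN.measurable t).sub (hN.measurable r)
  have h1 : ∀ ω, (-1 : ℝ) ^ N t ω * ((-1) ^ N r ω * F (pathPosition c (fun s => N s ω) r)) =
      (-1 : ℝ) ^ (N t ω - N r ω) * F (pathPosition c (fun s => N s ω) r) := fun ω => by
    have hle := hN.monotone_apply ω hrt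
    rw [← mul_assoc, ← pow_add]
    congr 1
    conv_lhs => rw [show N t ω + N r ω = (N t ω - N r ω) + 2 * N r ω by simp only at hle; omega]
    rw [pow_add, pow_mul]
    simp
  simp only [h1]
  have hlim1 := hN.tendsto_integral_mul_comp_pathSum hc r (hpow.comp hsub).aestronglyMeasurable
    (.of_forall fun _ => abs_neg_one_pow_le _) hF hF1
  have hlim2 := (hN.tendsto_integral_mul_comp_pathSum hc r (A := fun _ => 1)
    aestronglyMeasurable_const (.of_forall fun _ => by simp) hF hF1).const_mul
      (Real.exp (-2 * ∫ u in (r : ℝ)..t, rate u))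
  simp only [one_mul] at hlim2
  refine tendsto_nhds_unique hlim1 (hlim2.congr' ?_)
  filter_upwards [Filter.eventually_gt_atTop 0] with n hn
  rw [← hN.integral_neg_one_pow_sub hrt hrate]
  exact (IndepFun.integral_comp_mul_comp_eq (hN.indepFun_sub_pathSum (c := c) hrt hn) hsub
    (measurable_pathSum_apply hN.measurable r n) hpow hF.measurable).symm

end

/-! ### The Volterra system for the expectations. -/

section

variable {Ω : Type*} [MeasurableSpace Ω] {P : Measure Ω} {N : ℝ≥0 → Ω → ℕ} {w : ℝ → ℝ}
  {c0 lam0 : ℝ}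

theorem integral_mul_eq_mul_timeChange_sub (hwi : ∀ a b, IntervalIntegrable w volume a b)
    (k a b : ℝ) : ∫ u in a..b, k * w u = k * (timeChange w b - timeChange w a) := by
  rw [intervalIntegral.integral_const_mul, timeChange, timeChange,
    intervalIntegral.integral_interval_sub_left (hwi _ _) (hwi _ _)]

theorem integrable_prod_mul_of_abs_le_one [IsProbabilityMeasure P] {a b : ℝ}
    (hw : IntervalIntegrable w volume a b) {g : ℝ × Ω → ℝ} (hg : Measurable g)
    (hg1 : ∀ p, |g p| ≤ 1) :
    Integrable (fun p : ℝ × Ω => w p.1 * g p) ((volume.restrict (uIoc a b)).prod P) :=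
  ((intervalIntegrable_iff.1 hw).comp_fst P).mul_bdd hg.aestronglyMeasurable (.of_forall hg1)

-- The pathwise chain rule and Fubini's theorem give both equations of the Volterra system, with η =
-- ξ c₀. The parity weight on the sine is what closes the system.
set_option maxHeartbeats 1000000 in
theorem IsRegularPoissonProcess.integral_cos_pathPosition [IsProbabilityMeasure P]
    (hN : IsRegularPoissonProcess (fun s => lam0 * w s) N P) (hw : ∀ s, 0 ≤ w s)
    (hwm : Measurable w) (hwi : ∀ a b, IntervalIntegrable w volume a b) (hlam : 0 ≤ lam0)
    {ξ : ℝ} {C S : ℝ → ℝ}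
    (hC : ∀ x, HasDerivAt C ((lam0 ^ 2 - (ξ * c0) ^ 2) * S x) x) (hS : ∀ x, HasDerivAt S (C x) x)
    (hC0 : C 0 = 1) (hS0 : S 0 = 0) (t₀ : ℝ≥0) :
    ∫ ω, Real.cos (ξ * pathPosition (fun s => c0 * w s) (fun s => N s ω) t₀) ∂P =
      Real.exp (-lam0 * timeChange w t₀) *
        (C (timeChange w t₀) + lam0 * S (timeChange w t₀)) := by
  set Z : ℝ × Ω → ℝ := fun p => pathPosition (fun s => c0 * w s) (fun s => N s p.2) p.1 with hZ
  set Q : ℝ × Ω → ℝ := fun p => (-1 : ℝ) ^ N p.1.toNNReal p.2 with hQ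
  have hci : ∀ a b, IntervalIntegrable (fun s => c0 * w s) volume a b :=
    fun a b => (hwi a b).const_mul c0
  have hQm : Measurable Q := measurable_parity hN.measurable hN.rightContinuous_apply
  have hZm : Measurable Z := measurable_uncurry_pathPosition hci (hwm.const_mul c0) hN.measurable
    hN.rightContinuous_apply
  have hcosm : Measurable fun p => Real.cos (ξ * Z p) := Real.measurable_cos.comp (hZm.const_mul ξ)
  have hsinm : Measurable fun p => Q p * Real.sin (ξ * Z p) :=
    hQm.mul (Real.measurable_sin.comp (hZm.const_mul ξ))
  have hQ1 : ∀ p, |Q p| ≤ 1 := fun p => abs_neg_one_pow_le _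
  have hsin1 : ∀ p, |Q p * Real.sin (ξ * Z p)| ≤ 1 := fun p => by
    rw [abs_mul]
    exact mul_le_one₀ (hQ1 p) (abs_nonneg _) (Real.abs_sin_le_one _)
  have hmean : ∀ g : ℝ × Ω → ℝ, (∀ p, |g p| ≤ 1) → ∀ t, |∫ ω, g (t, ω) ∂P| ≤ 1 := fun g hg1 t => by
    have h := norm_integral_le_of_norm_le_const (μ := P) (f := fun ω => g (t, ω)) (C := 1)
      (.of_forall fun ω => hg1 (t, ω))
    simpa using h
  have hpath : ∀ ω t, IntervalIntegrable (fun s => c0 * w s * Q (s, ω)) volume 0 t := fun ω t =>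
    intervalIntegrable_mul_parity hci hN.measurable hN.rightContinuous_apply ω 0 t
  refine eq_of_volterra_system (u := fun t => ∫ ω, Real.cos (ξ * Z (t, ω)) ∂P)
    (v := fun t => ∫ ω, Q (t, ω) * Real.sin (ξ * Z (t, ω)) ∂P) (η := ξ * c0) hw hwi hlam
    t₀.coe_nonneg hcosm.stronglyMeasurable.integral_prod_right'.measurable
    hsinm.stronglyMeasurable.integral_prod_right'.measurable
    (hmean (fun p => Real.cos (ξ * Z p)) fun p => Real.abs_cos_le_one _)
    (hmean (fun p => Q p * Real.sin (ξ * Z p)) hsin1) ?_ ?_ hC hS hC0 hS0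
  · intro t ht
    have hd : ∀ x, HasDerivAt (fun x => Real.cos (ξ * x)) (-(ξ * Real.sin (ξ * x))) x := fun x =>
      (((hasDerivAt_id' x).const_mul ξ).cos).congr_deriv (by ring)
    have hpt : ∀ ω, Real.cos (ξ * Z (t, ω)) = 1 - ξ * c0 *
        ∫ r in (0 : ℝ)..t, w r * (Q (r, ω) * Real.sin (ξ * Z (r, ω))) := fun ω => by
      have h := integral_mul_deriv_comp_primitive (hpath ω t) hd (by fun_prop)
      have h2 : ∫ r in (0 : ℝ)..t, c0 * w r * Q (r, ω) *
          -(ξ * Real.sin (ξ * ∫ s in (0 : ℝ)..r, c0 * w s * Q (s, ω))) = -(ξ * c0) *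
          ∫ r in (0 : ℝ)..t, w r * (Q (r, ω) * Real.sin (ξ * Z (r, ω))) := by
        rw [← intervalIntegral.integral_const_mul]
        exact intervalIntegral.integral_congr fun r _ => by simp only [hZ, hQ, pathPosition]; ring
      rw [h2, mul_zero, Real.cos_zero] at h
      change _ = Real.cos (ξ * Z (t, ω)) - 1 at h
      linarith
    simp only [hpt]
    have hint := integrable_prod_mul_of_abs_le_one (P := P) (hwi 0 t) hsinm hsin1
    have hswap := intervalIntegral_integral_swap (μ := P) (a := 0) (b := t)
      (f := fun r ω => w r * (Q (r, ω) * Real.sin (ξ * Z (r, ω)))) hint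
    have hint2 : Integrable (fun ω => ∫ r in (0 : ℝ)..t,
        w r * (Q (r, ω) * Real.sin (ξ * Z (r, ω)))) P := by
      simp only [intervalIntegral.integral_of_le ht]
      rw [uIoc_of_le ht] at hint
      exact hint.integral_prod_right
    rw [integral_sub (integrable_const 1) (hint2.const_mul _), integral_const_mul, ← hswap]
    simp [integral_const_mul]
  · intro t ht
    have hd : ∀ x, HasDerivAt (fun x => Real.sin (ξ * x)) (ξ * Real.cos (ξ * x)) x := fun x =>
      (((hasDerivAt_id' x).const_mul ξ).sin).congr_deriv (by ring)
    -- The parity at time `t` is taken inside the integral, where it meets the parity at `r` and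
    -- becomes that of an increment.
    have hpt : ∀ ω, Q (t, ω) * Real.sin (ξ * Z (t, ω)) = ξ * c0 * ∫ r in (0 : ℝ)..t,
        w r * (Q (t, ω) * (Q (r, ω) * Real.cos (ξ * Z (r, ω)))) := fun ω => by
      have h := integral_mul_deriv_comp_primitive (hpath ω t) hd (by fun_prop)
      rw [mul_zero, Real.sin_zero, sub_zero] at h
      change _ = Real.sin (ξ * Z (t, ω)) at h
      rw [← h, ← intervalIntegral.integral_const_mul, ← intervalIntegral.integral_const_mul]
      refine intervalIntegral.integral_congr fun r _ => ?_
      simp only [hZ, hQ, pathPosition]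
      ring
    simp only [hpt]
    have hgm : Measurable fun p : ℝ × Ω => Q (t, p.2) * (Q p * Real.cos (ξ * Z p)) :=
      ((hQm.comp measurable_prodMk_left).comp measurable_snd).mul (hQm.mul hcosm)
    have hg1 : ∀ p : ℝ × Ω, |Q (t, p.2) * (Q p * Real.cos (ξ * Z p))| ≤ 1 := fun p => by
      rw [abs_mul, abs_mul]
      exact mul_le_one₀ (hQ1 _) (by positivity)
        (mul_le_one₀ (hQ1 p) (abs_nonneg _) (Real.abs_cos_le_one _))
    have hint := integrable_prod_mul_of_abs_le_one (P := P) (hwi 0 t) hgm hg1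
    have hswap := intervalIntegral_integral_swap (μ := P) (a := 0) (b := t)
      (f := fun r ω => w r * (Q (t, ω) * (Q (r, ω) * Real.cos (ξ * Z (r, ω))))) hint
    rw [integral_const_mul, ← hswap]
    congr 1
    refine intervalIntegral.integral_congr fun r hr => ?_
    rw [uIcc_of_le ht] at hr
    simp only [integral_const_mul]
    congr 1
    have hrt : r.toNNReal ≤ t.toNNReal := Real.toNNReal_le_toNNReal hr.2
    have hrate : 0 ≤ ∫ u in (r.toNNReal : ℝ)..t.toNNReal, lam0 * w u :=
      intervalIntegral.integral_nonneg hrt fun u _ => mul_nonneg hlam (hw u)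
    have h := hN.integral_parity_mul_parity_mul_comp hci hrt hrate (F := fun x => Real.cos (ξ * x))
      (by fun_prop) fun x => Real.abs_cos_le_one _
    rw [integral_mul_eq_mul_timeChange_sub hwi, Real.coe_toNNReal _ hr.1, Real.coe_toNNReal _ ht]
      at h
    rw [mul_assoc (-2 : ℝ)]
    exact h

end

/-! ### Reduction to regular weights and regular noise. -/

/-- A weight on `(0, ∞)` agrees almost everywhere with one that is measurable, nonnegative and
locally integrable on the whole line. -/
theorem exists_measurable_weight {w : ℝ → ℝ} (hw : ∀ s, 0 ≤ s → 0 ≤ w s)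
    (hint : ∀ t : ℝ, 0 ≤ t → IntervalIntegrable w volume 0 t) :
    ∃ w' : ℝ → ℝ, Measurable w' ∧ (∀ s, 0 ≤ w' s) ∧ (∀ a b, IntervalIntegrable w' volume a b) ∧
      ∀ᵐ s, 0 < s → w' s = w s := by
  have hU : (⋃ n : ℕ, Ioc (0 : ℝ) n) = Ioi 0 := by
    ext x
    simp only [mem_iUnion, mem_Ioc, mem_Ioi]
    exact ⟨fun ⟨_, h, _⟩ => h, fun h => (exists_nat_ge x).imp fun n hn => ⟨h, hn⟩⟩
  have hae : AEMeasurable w (volume.restrict (Ioi 0)) := by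
    rw [← hU, aemeasurable_iUnion_iff]
    exact fun n => (hint n n.cast_nonneg).1.aemeasurable
  have heq := (ae_restrict_iff' measurableSet_Ioi).1 hae.ae_eq_mk
  refine ⟨indicator (Ioi 0) fun s => max (hae.mk w s) 0,
    (hae.measurable_mk.max measurable_const).indicator measurableSet_Ioi,
    fun s => indicator_nonneg (fun _ _ => le_max_right _ _) s, ?_, ?_⟩
  · have h0 : ∀ t, IntervalIntegrable (indicator (Ioi 0) fun s => max (hae.mk w s) 0) volume 0 t := by
      intro t
      rcases le_total 0 t with ht | ht
      · refine (hint t ht).congr_ae ((ae_restrict_iff' measurableSet_uIoc).2 ?_)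
        filter_upwards [heq] with s hs hst
        rw [uIoc_of_le ht] at hst
        rw [indicator_of_mem (mem_Ioi.2 hst.1), ← hs hst.1, max_eq_left (hw s hst.1.le)]
      · refine (intervalIntegrable_const (c := (0 : ℝ))).congr_ae
          ((ae_restrict_iff' measurableSet_uIoc).2 (.of_forall fun s hst => ?_))
        rw [uIoc_of_ge ht] at hst
        rw [indicator_of_notMem (by simpa using hst.2)]
    exact fun a b => (h0 a).symm.trans (h0 b)
  · filter_upwards [heq] with s hs hs0
    rw [indicator_of_mem (mem_Ioi.2 hs0), ← hs hs0, max_eq_left (hw s hs0.le)]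

theorem integral_mul_congr_weight {w w' : ℝ → ℝ} (h : ∀ᵐ s, 0 < s → w' s = w s) (k : ℝ)
    (g : ℝ → ℝ) {a b : ℝ} (ha : 0 ≤ a) (hb : 0 ≤ b) :
    ∫ s in a..b, k * w' s * g s = ∫ s in a..b, k * w s * g s := by
  refine intervalIntegral.integral_congr_ae ?_
  filter_upwards [h] with s hs hsab
  rw [hs ((le_min ha hb).trans_lt hsab.1)]

theorem telegraphPosition_eq {Ω : Type*} (c : ℝ → ℝ) (D : Ω → ℝ) (N : ℝ≥0 → Ω → ℕ) (t : ℝ≥0) (ω : Ω) :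
    telegraphPosition c D N t ω = D ω * pathPosition c (fun s => N s ω) t := by
  rw [telegraphPosition, pathPosition, ← intervalIntegral.integral_const_mul]
  refine intervalIntegral.integral_congr fun s hs => ?_
  rw [uIcc_of_le t.coe_nonneg] at hs
  simp only [telegraphVelocity, Real.coe_toNNReal _ hs.1]
  ring

section

variable {Ω : Type*} [MeasurableSpace Ω] {P : Measure Ω} {N : ℝ≥0 → Ω → ℕ} {D : Ω → ℝ}

theorem IsPoissonProcess.congr_rate {rate rate' : ℝ → ℝ} (h : IsPoissonProcess rate N P)
    (hr : ∀ s t : ℝ≥0, ∫ u in (s : ℝ)..t, rate u = ∫ u in (s : ℝ)..t, rate' u) :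
    IsPoissonProcess rate' N P where
  measurable := h.measurable
  zero := h.zero
  monotone := h.monotone
  rightContinuous := h.rightContinuous
  increments s t hst := by rw [h.increments s t hst, hr]
  indepIncrements := h.indepIncrements

theorem IsTelegraphNoise.ae_dir {rate : ℝ → ℝ} [IsProbabilityMeasure P]
    (h : IsTelegraphNoise rate D N P) : ∀ᵐ ω ∂P, D ω = 1 ∨ D ω = -1 := by
  have hm1 : MeasurableSet {ω | D ω = 1} := h.measurable_dir (measurableSet_singleton 1)
  have hm2 : MeasurableSet {ω | D ω = -1} := h.measurable_dir (measurableSet_singleton (-1))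
  have hdisj : Disjoint {ω | D ω = 1} {ω | D ω = -1} := by
    rw [Set.disjoint_left]
    intro ω h1 h2
    simp only [mem_ofPred_eq] at h1 h2
    linarith
  have hP : P ({ω | D ω = 1} ∪ {ω | D ω = -1}) = 1 := by
    rw [measure_union hdisj hm2, h.dir_pos, h.dir_neg, ENNReal.add_halves]
  exact (mem_ae_iff_prob_eq_one (hm1.union hm2)).2 hP

theorem IsTelegraphNoise.integral_dir {rate : ℝ → ℝ} [IsProbabilityMeasure P]
    (h : IsTelegraphNoise rate D N P) : ∫ ω, D ω ∂P = 0 := by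
  have hm1 : MeasurableSet {ω | D ω = 1} := h.measurable_dir (measurableSet_singleton 1)
  have hm2 : MeasurableSet {ω | D ω = -1} := h.measurable_dir (measurableSet_singleton (-1))
  have heq : D =ᵐ[P] fun ω => indicator {ω | D ω = 1} (fun _ => (1 : ℝ)) ω -
      indicator {ω | D ω = -1} (fun _ => (1 : ℝ)) ω := by
    filter_upwards [h.ae_dir] with ω hω
    rcases hω with hω | hω <;> simp [indicator, hω] <;> norm_num
  rw [integral_congr_ae heq, integral_sub ((integrable_const 1).indicator hm1)
    ((integrable_const 1).indicator hm2), integral_indicator hm1, integral_indicator hm2]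
  simp [measureReal_def, h.dir_pos, h.dir_neg]

/-- The noise of a telegraph process can be modified on a null event so that all its paths are
regular. -/
theorem IsTelegraphNoise.exists_regular {rate : ℝ → ℝ} [IsProbabilityMeasure P]
    (h : IsTelegraphNoise rate D N P) :
    ∃ (D' : Ω → ℝ) (N' : ℝ≥0 → Ω → ℕ), IsTelegraphNoise rate D' N' P ∧
      IsRegularPoissonProcess rate N' P ∧ (∀ ω, D' ω = 1 ∨ D' ω = -1) ∧
      ∀ᵐ ω ∂P, D' ω = D ω ∧ ∀ t, N' t ω = N t ω := by
  classical
  -- All almost sure properties hold on one measurable event `E` of full measure; off `E` the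
  -- direction is set to 1 and the count to 0.
  obtain ⟨E, hE, hEm, hgood⟩ := ((h.ae_dir.and h.poisson.zero).and
    (h.poisson.monotone.and h.poisson.rightContinuous)).exists_measurable_mem
  set D' : Ω → ℝ := E.piecewise D fun _ => 1 with hD'
  set N' : ℝ≥0 → Ω → ℕ := fun t => E.piecewise (N t) fun _ => 0 with hN'
  have hNE : ∀ {ω}, ω ∈ E → ∀ t, N' t ω = N t ω := fun hω t => piecewise_eq_of_mem _ _ _ hω
  have hNE' : ∀ {ω}, ω ∉ E → ∀ t, N' t ω = 0 := fun hω t => piecewise_eq_of_notMem _ _ _ hω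
  have hDE : ∀ {ω}, ω ∈ E → D' ω = D ω := fun hω => piecewise_eq_of_mem _ _ _ hω
  have hDae : D =ᵐ[P] D' := by filter_upwards [hE] with ω hω using (hDE hω).symm
  have hNae : ∀ t, N t =ᵐ[P] N' t := fun t => by
    filter_upwards [hE] with ω hω using (hNE hω t).symm
  have hmono : ∀ ω, Monotone fun t => N' t ω := fun ω => by
    by_cases hω : ω ∈ E
    · simpa only [hNE hω] using (hgood ω hω).2.1
    · simpa only [hNE' hω] using monotone_const
  have hrc : ∀ ω t, ContinuousWithinAt (fun s => N' s ω) (Ici t) t := fun ω t => by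
    by_cases hω : ω ∈ E
    · simpa only [hNE hω] using (hgood ω hω).2.2 t
    · simpa only [hNE' hω] using continuousWithinAt_const
  have hzero : ∀ ω, N' 0 ω = 0 := fun ω => by
    by_cases hω : ω ∈ E
    · rw [hNE hω, (hgood ω hω).1.2]
    · exact hNE' hω 0
  have hpois : IsPoissonProcess rate N' P :=
    { measurable := fun t => (h.poisson.measurable t).piecewise hEm measurable_const
      zero := .of_forall hzero
      monotone := .of_forall hmono
      rightContinuous := .of_forall hrc
      increments := fun s t hst => by
        rw [← h.poisson.increments s t hst]
        refine Measure.map_congr ?_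
        filter_upwards [hE] with ω hω
        rw [hNE hω, hNE hω]
      indepIncrements := fun n t ht => (h.poisson.indepIncrements n t ht).congr fun i => by
        filter_upwards [hE] with ω hω
        rw [hNE hω, hNE hω] }
  refine ⟨D', N', ?_, ⟨hpois, hzero, hmono, hrc⟩, fun ω => ?_, ?_⟩
  · refine ⟨hpois, h.measurable_dir.piecewise hEm measurable_const, ?_, ?_, ?_⟩
    · rw [← h.dir_pos]
      exact measure_congr (hDae.mono fun ω hω => by
        change (D' ω = 1) = (D ω = 1); rw [hω])
    · rw [← h.dir_neg]
      exact measure_congr (hDae.mono fun ω hω => by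
        change (D' ω = -1) = (D ω = -1); rw [hω])
    · refine h.indep.congr hDae ?_
      filter_upwards [hE] with ω hω
      funext t
      exact (hNE hω t).symm
  · by_cases hω : ω ∈ E
    · rw [hDE hω]
      exact (hgood ω hω).1.1
    · exact Or.inl (piecewise_eq_of_notMem _ _ _ hω)
  · filter_upwards [hE] with ω hω using ⟨hDE hω, hNE hω⟩

variable {w : ℝ → ℝ} {c0 lam0 : ℝ}

/-- The law of a telegraph process with regular noise and regular weight. -/
theorem IsTelegraphNoise.map_dir_mul_pathPosition [IsProbabilityMeasure P]
    (hDN : IsTelegraphNoise (fun s => lam0 * w s) D N P)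
    (hN : IsRegularPoissonProcess (fun s => lam0 * w s) N P) (hD : ∀ ω, D ω = 1 ∨ D ω = -1)
    (hc0 : 0 < c0) (hlam0 : 0 ≤ lam0) (hw : ∀ s, 0 ≤ w s) (hwm : Measurable w)
    (hwi : ∀ a b, IntervalIntegrable w volume a b) (t : ℝ≥0) :
    Measurable (fun ω => D ω * pathPosition (fun s => c0 * w s) (fun s => N s ω) t) ∧
    P.map (fun ω => D ω * pathPosition (fun s => c0 * w s) (fun s => N s ω) t) =
      classicalLaw c0 lam0 (timeChange w t) := by
  have hci : ∀ a b, IntervalIntegrable (fun s => c0 * w s) volume a b :=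
    fun a b => (hwi a b).const_mul c0
  have hZm : Measurable fun ω => pathPosition (fun s => c0 * w s) (fun s => N s ω) t :=
    (measurable_uncurry_pathPosition hci (hwm.const_mul c0) hN.measurable
      hN.rightContinuous_apply).comp measurable_prodMk_left
  have hXm : Measurable fun ω => D ω * pathPosition (fun s => c0 * w s) (fun s => N s ω) t :=
    hDN.measurable_dir.mul hZm
  refine ⟨hXm, ?_⟩
  have hprob : IsProbabilityMeasure
      (P.map (fun ω => D ω * pathPosition (fun s => c0 * w s) (fun s => N s ω) t)) :=
    Measure.isProbabilityMeasure_map hXm.aemeasurable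
  refine Measure.ext_of_charFun (funext fun ξ => ?_)
  obtain ⟨C, S, hC, hS, hC0, hS0, hCs, hSs⟩ := exists_fundamental_solutions (lam0 ^ 2 - (ξ * c0) ^ 2)
  rw [charFun_classicalLaw hc0 hlam0 (timeChange_nonneg hw t.coe_nonneg) (hCs _) (hSs _),
    ← hN.integral_cos_pathPosition hw hwm hwi hlam0 hC hS hC0 hS0 t, charFun_apply_real,
    integral_map hXm.aemeasurable (by fun_prop)]
  -- The direction has mean zero and is independent of each path sum, a measurable function on path
  -- space. The vanishing passes to the limit.
  have hsin : ∫ ω, D ω *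
      Real.sin (ξ * pathPosition (fun s => c0 * w s) (fun s => N s ω) t) ∂P = 0 := by
    have hlim := hN.tendsto_integral_mul_comp_pathSum hci t (A := D)
      hDN.measurable_dir.aestronglyMeasurable
      (.of_forall fun ω => by rcases hD ω with h | h <;> simp [h])
      (F := fun x => Real.sin (ξ * x)) (by fun_prop) fun x => Real.abs_sin_le_one _
    refine tendsto_nhds_unique hlim (tendsto_const_nhds.congr fun n => ?_)
    have hind : IndepFun D (fun ω => pathSum (fun s => c0 * w s) t n fun s => N s ω) P :=
      hDN.indep.comp measurable_id (measurable_pathSum _ t n)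
    have := IndepFun.integral_comp_mul_comp_eq hind hDN.measurable_dir
      (measurable_pathSum_apply hN.measurable t n) measurable_id
      (g := fun x => Real.sin (ξ * x)) (by fun_prop)
    simp only [id, hDN.integral_dir, zero_mul] at this
    exact this.symm
  -- As the direction is ±1, it drops out of the even cosine and factors out of the odd sine.
  have hpt : ∀ ω, Complex.exp (ξ * ((D ω *
      pathPosition (fun s => c0 * w s) (fun s => N s ω) t : ℝ) : ℂ) * Complex.I) =
      ((Real.cos (ξ * pathPosition (fun s => c0 * w s) (fun s => N s ω) t) : ℝ) : ℂ) +
      ((D ω * Real.sin (ξ * pathPosition (fun s => c0 * w s) (fun s => N s ω) t) : ℝ) : ℂ) *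
        Complex.I := fun ω => by
    rw [Complex.exp_mul_I]
    rcases hD ω with h | h <;> simp [h]
  have hi1 : Integrable (fun ω =>
      Real.cos (ξ * pathPosition (fun s => c0 * w s) (fun s => N s ω) t)) P :=
    Integrable.of_bound (Real.measurable_cos.comp (hZm.const_mul ξ)).aestronglyMeasurable 1
      (.of_forall fun ω => Real.abs_cos_le_one _)
  have hi2 : Integrable (fun ω => D ω *
      Real.sin (ξ * pathPosition (fun s => c0 * w s) (fun s => N s ω) t)) P :=
    Integrable.of_bound (hDN.measurable_dir.mul
      (Real.measurable_sin.comp (hZm.const_mul ξ))).aestronglyMeasurable 1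
      (.of_forall fun ω => by rcases hD ω with h | h <;> simp [h, Real.abs_sin_le_one])
  simp only [hpt]
  rw [integral_add hi1.ofReal (hi2.ofReal.mul_const _), integral_mul_const, integral_complex_ofReal,
    integral_complex_ofReal, hsin]
  simp

theorem timeChange_congr_weight {w w' : ℝ → ℝ} (h : ∀ᵐ s, 0 < s → w' s = w s) {t : ℝ} (ht : 0 ≤ t) :
    timeChange w' t = timeChange w t := by
  simpa [timeChange] using integral_mul_congr_weight h 1 (fun _ => 1) le_rfl ht

/-- The law of a non-homogeneous telegraph process. -/
theorem IsTelegraphNoise.map_telegraphPosition [IsProbabilityMeasure P]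
    (hDN : IsTelegraphNoise (fun s => lam0 * w s) D N P) (hc0 : 0 < c0) (hlam0 : 0 ≤ lam0)
    (hw : ∀ s, 0 ≤ s → 0 ≤ w s) (hint : ∀ t : ℝ, 0 ≤ t → IntervalIntegrable w volume 0 t)
    (t : ℝ≥0) :
    AEMeasurable (telegraphPosition (fun s => c0 * w s) D N t) P ∧
    P.map (telegraphPosition (fun s => c0 * w s) D N t) =
      classicalLaw c0 lam0 (timeChange w t) := by
  obtain ⟨w', hwm', hw', hwi', hww'⟩ := exists_measurable_weight hw hint
  have hrate : ∀ s t : ℝ≥0, ∫ u in (s : ℝ)..t, lam0 * w u = ∫ u in (s : ℝ)..t, lam0 * w' u :=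
    fun s t => by
      simpa using (integral_mul_congr_weight hww' lam0 (fun _ => 1) s.coe_nonneg t.coe_nonneg).symm
  have hDN' : IsTelegraphNoise (fun s => lam0 * w' s) D N P :=
    ⟨hDN.poisson.congr_rate hrate, hDN.measurable_dir, hDN.dir_pos, hDN.dir_neg, hDN.indep⟩
  obtain ⟨D', N', hDN'', hN', hD', hae⟩ := hDN'.exists_regular
  obtain ⟨hm, hlaw⟩ := hDN''.map_dir_mul_pathPosition hN' hD' hc0 hlam0 hw' hwm' hwi' t
  have hX : (fun ω => D' ω * pathPosition (fun s => c0 * w' s) (fun s => N' s ω) t) =ᵐ[P]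
      telegraphPosition (fun s => c0 * w s) D N t := by
    filter_upwards [hae] with ω hω
    rw [telegraphPosition_eq, hω.1]
    simp only [hω.2]
    congr 1
    exact integral_mul_congr_weight hww' c0 _ le_rfl t.coe_nonneg
  refine ⟨⟨_, hm, hX.symm⟩, ?_⟩
  rw [← Measure.map_congr hX, hlaw, timeChange_congr_weight hww' t.coe_nonneg]

end

/-! ### The density formula, the atoms and the event of no switch. -/

theorem besselTerm_eq {c0 lam0 x t : ℝ} {w : ℝ → ℝ} (hx : |x| ≤ c0 * timeChange w t) :
    besselTerm c0 lam0 w x t =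
      besselSeries ((lam0 / (2 * c0)) ^ 2 * ((c0 * timeChange w t) ^ 2 - x ^ 2)) := by
  have h : 0 ≤ (c0 * timeChange w t) ^ 2 - x ^ 2 :=
    sub_nonneg.2 (sq_le_sq' (abs_le.1 hx).1 (abs_le.1 hx).2)
  rw [besselTerm, besselI0_eq, mul_pow, Real.sq_sqrt h]
  congr 1
  ring

theorem hasDerivAt_besselTerm {c0 lam0 x t : ℝ} {w : ℝ → ℝ} (hc0 : 0 < c0)
    (hx : |x| < c0 * timeChange w t) (hd : HasDerivAt (timeChange w) (w t) t) :
    HasDerivAt (fun u => besselTerm c0 lam0 w x u)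
      (w t * (lam0 ^ 2 * timeChange w t / 2 *
        besselSeriesDeriv ((lam0 / (2 * c0)) ^ 2 * ((c0 * timeChange w t) ^ 2 - x ^ 2)))) t := by
  -- The square root disappears only where its argument is nonnegative; the strict bound on |x|
  -- persists near `t` by continuity of τ.
  have hev : (fun u => besselTerm c0 lam0 w x u) =ᶠ[nhds t]
      fun u => besselSeries ((lam0 / (2 * c0)) ^ 2 * ((c0 * timeChange w u) ^ 2 - x ^ 2)) := by
    filter_upwards [(hd.continuousAt.const_mul c0).eventually (lt_mem_nhds hx)] with u hu
    exact besselTerm_eq hu.le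
  refine HasDerivAt.congr_of_eventuallyEq ?_ hev
  refine ((hasDerivAt_besselSeries _).comp t
    ((((hd.const_mul c0).pow 2).sub_const (x ^ 2)).const_mul ((lam0 / (2 * c0)) ^ 2))).congr_deriv ?_
  simp only [Pi.pow_apply]
  field_simp
  ring

/-- Differentiating through τ produces a factor w(t), which the prefactor 1 / (c₀ w(t)) cancels;
only τ(t) is left. -/
theorem telegraphDensity_eq {c0 lam0 x t : ℝ} {w : ℝ → ℝ} (hc0 : 0 < c0) (hwt : 0 < w t)
    (hx : |x| < c0 * timeChange w t) (hd : HasDerivAt (timeChange w) (w t) t) :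
    telegraphDensity c0 lam0 w t x = classicalDensity c0 lam0 (timeChange w t) x := by
  rw [telegraphDensity, classicalDensity, (hasDerivAt_besselTerm hc0 hx hd).deriv,
    besselTerm_eq hx.le]
  field_simp

theorem timeChange_one (t : ℝ) : timeChange (fun _ => 1) t = t := by
  simp [timeChange]

theorem ae_hasDerivAt_timeChange {w : ℝ → ℝ}
    (hint : ∀ t : ℝ, 0 ≤ t → IntervalIntegrable w volume 0 t) :
    ∀ᵐ t ∂(volume.restrict (Ioi (0 : ℝ))), HasDerivAt (timeChange w) (w t) t := by
  have h : ∀ᵐ t : ℝ, ∀ n : ℕ, t ∈ uIcc (0 : ℝ) n → HasDerivAt (timeChange w) (w t) t := by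
    refine ae_all_iff.2 fun n => ?_
    filter_upwards [(hint n n.cast_nonneg).ae_hasDerivAt_integral] with t ht htn
    exact ht htn 0 left_mem_uIcc
  rw [ae_restrict_iff' measurableSet_Ioi]
  filter_upwards [h] with t ht ht0
  obtain ⟨n, hn⟩ := exists_nat_ge t
  refine ht n ?_
  rw [uIcc_of_le n.cast_nonneg]
  exact ⟨le_of_lt ht0, hn⟩

theorem classicalLaw_singleton {c lam T : ℝ} (hc : 0 < c) (hT : 0 < T) :
    classicalLaw c lam T {c * T} = ENNReal.ofReal (Real.exp (-lam * T) / 2) ∧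
    classicalLaw c lam T {-(c * T)} = ENNReal.ofReal (Real.exp (-lam * T) / 2) := by
  have h0 : ∀ a : ℝ, (volume.restrict {x : ℝ | |x| < c * T}).withDensity
      (fun x => ENNReal.ofReal (classicalDensity c lam T x)) {a} = 0 := fun a =>
    withDensity_absolutelyContinuous _ _
      (Measure.restrict_le_self.absolutelyContinuous (measure_singleton a))
  have hcT : 0 < c * T := mul_pos hc hT
  -- For positive `T` the endpoints differ, so each carries only one of the two Dirac masses.
  have h1 : -(c * T) ≠ c * T := by linarith
  constructor <;> simp [classicalLaw, h0, h1, h1.symm]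

theorem IsPoissonProcess.measure_eq_zero {Ω : Type*} [MeasurableSpace Ω] {P : Measure Ω}
    {N : ℝ≥0 → Ω → ℕ} {rate : ℝ → ℝ} (hN : IsPoissonProcess rate N P) (t : ℝ≥0)
    (hrate : 0 ≤ ∫ u in (0 : ℝ)..t, rate u) :
    P {ω | N t ω = 0} = ENNReal.ofReal (Real.exp (-∫ u in (0 : ℝ)..t, rate u)) := by
  have h := hN.increments 0 t t.2
  have hmap : P.map (fun ω => N t ω - N 0 ω) = P.map (N t) := by
    refine Measure.map_congr ?_
    filter_upwards [hN.zero] with ω hω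
    rw [hω, Nat.sub_zero]
  rw [hmap] at h
  have h2 := congrArg (fun μ : Measure ℕ => μ {0}) h
  simp only [Measure.map_apply (hN.measurable t) (measurableSet_singleton 0),
    poissonMeasure_singleton] at h2
  rw [NNReal.coe_zero, Real.coe_toNNReal _ hrate] at h2
  rw [show {ω | N t ω = 0} = N t ⁻¹' {0} from rfl]
  simpa using h2

theorem timeChange_nonneg_of_nonneg {w : ℝ → ℝ} (hw : ∀ s, 0 ≤ s → 0 ≤ w s) (t : ℝ≥0) :
    0 ≤ timeChange w t :=
  intervalIntegral.integral_nonneg t.2 fun s hs => hw s hs.1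

theorem telegraphPosition_eq_of_no_switch {Ω : Type*} {c : ℝ → ℝ} {D : Ω → ℝ} {N : ℝ≥0 → Ω → ℕ}
    {t : ℝ≥0} {ω : Ω} (hmono : Monotone fun s => N s ω) (hD : D ω = 1 ∨ D ω = -1)
    (hNt : N t ω = 0) :
    telegraphPosition c D N t ω = (∫ s in (0 : ℝ)..t, c s) ∨
      telegraphPosition c D N t ω = -∫ s in (0 : ℝ)..t, c s := by
  have hZ : pathPosition c (fun s => N s ω) t = ∫ s in (0 : ℝ)..t, c s := by
    refine intervalIntegral.integral_congr fun s hs => ?_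
    rw [uIcc_of_le t.coe_nonneg] at hs
    have hle : N s.toNNReal ω ≤ N t ω := hmono (Real.toNNReal_le_iff_le_coe.2 hs.2)
    simp [Nat.le_zero.1 (hle.trans_eq hNt)]
  rw [telegraphPosition_eq, hZ]
  rcases hD with h | h <;> simp [h]

/-! ### The main theorem. -/

theorem mainTheorem1 {Ω : Type u} [MeasurableSpace Ω] (P : Measure Ω) [IsProbabilityMeasure P]
    (c0 lam0 : ℝ) (hc0 : 0 < c0) (hlam0 : 0 < lam0)
    (w : ℝ → ℝ) (hw : ∀ s, 0 ≤ s → 0 ≤ w s)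
    (hint : ∀ t : ℝ, 0 ≤ t → IntervalIntegrable w volume 0 t)
    (D : Ω → ℝ) (N : ℝ≥0 → Ω → ℕ)
    (hDN : IsTelegraphNoise (fun s => lam0 * w s) D N P)
    (X : ℝ≥0 → Ω → ℝ) (hX : X = telegraphPosition (fun s => c0 * w s) D N) :
    -- positions are random variables
    (∀ t : ℝ≥0, AEMeasurable (X t) P) ∧
    -- reduction to the classical telegraph process with constant `c0`, `lam0` at time `τ`
    (∀ (Ω' : Type v) [MeasurableSpace Ω'] (P' : Measure Ω') [IsProbabilityMeasure P']
        (D' : Ω' → ℝ) (N' : ℝ≥0 → Ω' → ℕ), IsTelegraphNoise (fun _ => lam0) D' N' P' →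
      ∀ t : ℝ≥0, P.map (X t) =
        P'.map (telegraphPosition (fun _ => c0) D' N' (timeChange w t).toNNReal)) ∧
    -- the time change has derivative `w t` at almost every `t`
    (∀ᵐ t ∂(volume.restrict (Ioi (0 : ℝ))), HasDerivAt (timeChange w) (w t) t) ∧
    -- at such times with `w t > 0`: the absolutely continuous part and the singular part
    (∀ t : ℝ≥0, 0 < t → 0 < w t → HasDerivAt (timeChange w) (w t) t →
      (∀ x : ℝ, |x| < c0 * timeChange w t →
        DifferentiableAt ℝ (fun u => besselTerm c0 lam0 w x u) t ∧
        0 ≤ telegraphDensity c0 lam0 w t x) ∧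
      P.map (X t) =
        (volume.restrict {x : ℝ | |x| < c0 * timeChange w t}).withDensity
            (fun x => ENNReal.ofReal (telegraphDensity c0 lam0 w t x)) +
          ENNReal.ofReal (Real.exp (-lam0 * timeChange w t) / 2) •
            (Measure.dirac (∫ s in (0 : ℝ)..t, c0 * w s) +
              Measure.dirac (-∫ s in (0 : ℝ)..t, c0 * w s))) ∧
    -- boundary atoms
    (∀ t : ℝ≥0, 0 < timeChange w t →
      P {ω | X t ω = ∫ s in (0 : ℝ)..t, c0 * w s} =
        ENNReal.ofReal (Real.exp (-lam0 * timeChange w t) / 2) ∧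
      P {ω | X t ω = -∫ s in (0 : ℝ)..t, c0 * w s} =
        ENNReal.ofReal (Real.exp (-lam0 * timeChange w t) / 2)) ∧
    -- up to null events, the boundary is occupied exactly when no switch has occurred
    (∀ t : ℝ≥0, ∀ᵐ ω ∂P,
      ((X t ω = ∫ s in (0 : ℝ)..t, c0 * w s) ∨ (X t ω = -∫ s in (0 : ℝ)..t, c0 * w s)) ↔
        N t ω = 0) := by
  subst hX
  have hlaw := hDN.map_telegraphPosition hc0 hlam0.le hw hint
  have hτ := timeChange_nonneg_of_nonneg hw
  have hend : ∀ t : ℝ≥0, ∫ s in (0 : ℝ)..t, c0 * w s = c0 * timeChange w t :=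
    fun t => intervalIntegral.integral_const_mul _ _
  have hatoms : ∀ t : ℝ≥0, 0 < timeChange w t →
      P {ω | telegraphPosition (fun s => c0 * w s) D N t ω = ∫ s in (0 : ℝ)..t, c0 * w s} =
        ENNReal.ofReal (Real.exp (-lam0 * timeChange w t) / 2) ∧
      P {ω | telegraphPosition (fun s => c0 * w s) D N t ω = -∫ s in (0 : ℝ)..t, c0 * w s} =
        ENNReal.ofReal (Real.exp (-lam0 * timeChange w t) / 2) := fun t ht => by
    have h := classicalLaw_singleton (lam := lam0) hc0 ht
    rw [← (hlaw t).2, Measure.map_apply_of_aemeasurable (hlaw t).1 (measurableSet_singleton _),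
      Measure.map_apply_of_aemeasurable (hlaw t).1 (measurableSet_singleton _), ← hend t] at h
    exact h
  refine ⟨fun t => (hlaw t).1, ?_, ae_hasDerivAt_timeChange hint, ?_, hatoms, ?_⟩
  · intro Ω' _ P' _ D' N' hDN' t
    -- The classical process is the case of weight 1, for which the time change is the identity.
    have h1 : IsTelegraphNoise (fun s => lam0 * (fun _ : ℝ => (1 : ℝ)) s) D' N' P' := by
      simpa using hDN'
    have h := (h1.map_telegraphPosition hc0 hlam0.le (fun _ _ => zero_le_one)
      (fun _ _ => intervalIntegrable_const) (timeChange w t).toNNReal).2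
    simp only [mul_one, timeChange_one, Real.coe_toNNReal _ (hτ t)] at h
    rw [(hlaw t).2, h]
  · intro t _ hwt hd
    refine ⟨fun x hx => ⟨(hasDerivAt_besselTerm hc0 hx hd).differentiableAt, ?_⟩, ?_⟩
    · rw [telegraphDensity_eq hc0 hwt hx hd]
      exact classicalDensity_nonneg hc0 hlam0.le (hτ t) hx.le
    · rw [(hlaw t).2, hend, classicalLaw]
      congr 1
      refine withDensity_congr_ae ?_
      have hms : MeasurableSet {x : ℝ | |x| < c0 * timeChange w t} := by
        rw [setOf_abs_lt_eq_Ioo]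
        exact measurableSet_Ioo
      refine (ae_restrict_iff' hms).2 (.of_forall fun x hx => ?_)
      simp only [telegraphDensity_eq hc0 hwt hx hd]
  · intro t
    have hrate : ∫ u in (0 : ℝ)..t, lam0 * w u = lam0 * timeChange w t :=
      intervalIntegral.integral_const_mul _ _
    have hN0 := hDN.poisson.measure_eq_zero t (by rw [hrate]; exact mul_nonneg hlam0.le (hτ t))
    rw [hrate] at hN0
    have hsub : {ω | N t ω = 0} ≤ᵐ[P]
        {ω | telegraphPosition (fun s => c0 * w s) D N t ω = (∫ s in (0 : ℝ)..t, c0 * w s) ∨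
          telegraphPosition (fun s => c0 * w s) D N t ω = -∫ s in (0 : ℝ)..t, c0 * w s} := by
      filter_upwards [hDN.poisson.monotone, hDN.ae_dir] with ω hmono hD hNt
      exact telegraphPosition_eq_of_no_switch hmono hD hNt
    -- For τ > 0 the two atoms add up to exp(-λ₀τ), the probability of no switch; for τ = 0 that
    -- probability is 1. With the almost sure inclusion of the no-switch event, this forces almost
    -- sure equality.
    have hle : P {ω | telegraphPosition (fun s => c0 * w s) D N t ω =
          (∫ s in (0 : ℝ)..t, c0 * w s) ∨
        telegraphPosition (fun s => c0 * w s) D N t ω = -∫ s in (0 : ℝ)..t, c0 * w s} ≤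
        P {ω | N t ω = 0} := by
      rw [hN0]
      rcases (hτ t).eq_or_lt with h0 | h0
      · rw [← h0]
        simpa using prob_le_one
      · refine (measure_union_le
          {ω | telegraphPosition (fun s => c0 * w s) D N t ω = ∫ s in (0 : ℝ)..t, c0 * w s}
          {ω | telegraphPosition (fun s => c0 * w s) D N t ω =
            -∫ s in (0 : ℝ)..t, c0 * w s}).trans_eq ?_
        rw [(hatoms t h0).1, (hatoms t h0).2, ← ENNReal.ofReal_add (by positivity) (by positivity),
          add_halves, neg_mul]
    have heq := ae_eq_of_ae_subset_of_measure_ge hsub hle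
      ((hDN.poisson.measurable t (measurableSet_singleton 0)).nullMeasurableSet)
      (measure_ne_top P _)
    filter_upwards [heq] with ω hω
    exact (iff_of_eq hω).symm
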